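/- Let $d\ge 5$, $\mathcal A=\{0,\dots,d-1\}$, and let $T_d$ be the $d$-regular rooted tree of finite words over $\mathcal A$. The alternating mother group is the subgroup $M=\langle A,B_0\rangle<\operatorname{Aut}(T_d)$, where $A$ is the alternating group over $d$ elements acting on the first level with trivial sections, and $B_0$ is the set of all automorphisms with a wreath recursion of the form $g=(g,\sigma_1,\dots,\sigma_{d-1})\rho$ in which $\sigma_1,\dots,\sigma_{d-1},\rho$ are alternating permutations of $\mathcal A$ and $\rho(0)=0$ (here $\rho$ is the action of $g$ on the first level, $g$ itself is its section at $0$, and $\sigma_i$, acting on the first level with trivial sections, is its section at $i$). Let $\operatorname{Sub}(M)$ be the space of subgroups of $M$ with the Chabauty topology (induced from $\{0,1\}^M$), on which $M$ acts by conjugation, and let the Schreier dynamical system $X\subset\operatorname{Sub}(M)$ of $M$ be the closure of the set of stabilisers $\operatorname{Stab}(y)$ of the points $y\in\partial T_d$ at which the stabiliser map $\partial T_d\to\operatorname{Sub}(M)$ is continuous. For a Bratteli diagram $B$ (finite vertex levels $V_n$ and finite edge sets $E_n$ from $V_n$ to $V_{n+1}$, $n\ge 0$, with a single top vertex, which is the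 only vertex without incoming edges, and with no vertex without outgoing edges), let $X_B$ be the space of infinite directed paths from the top vertex, with the topology induced by the product of the discrete topologies. For a finite path $\gamma$ from the top vertex let $C_\gamma\subset X_B$ be the cylinder of infinite paths that start with $\gamma$, and for finite paths $\gamma,\gamma'$ with the same end vertex let $\tau_{\gamma,\gamma'}\colon C_\gamma\to C_{\gamma'}$ be the homeomorphism that replaces the beginning $\gamma$ by $\gamma'$. The tail groupoid $\mathcal H_B$ is the groupoid of germs of the pseudogroup generated by all $\tau_{\gamma,\gamma'}$. A homeomorphism $g$ of $X_B$ is of bounded type if the number of cylinders $C_\gamma$, with $\gamma$ ending at a vertex $v$, such that $g|_{C_\gamma}$ is not equal to $\tau_{\gamma,\gamma'}$ for any $\gamma'$, is bounded uniformly in $v$, and the set of points $x\in X_B$ at which the germ of $g$ does not belong to $\mathcal H_B$ is finite. The diagram is simple if for every vertex $v\in V_n$ there is $m>n$ such that $v$ is connected by a directed path to every vertex of $V_m$; it is stationary if the levels $V_1,V_2,\dots$ can be identified with one set in such a way that the number of edges between two given vertices is the same in all $E_n$, $n\ge1$. Theorem. There exist a stationary, simple Bratteli diagram $B$ and a homeomorphism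 $X\simeq X_B$ that conjugates the action $M\curvearrowright X$ to an action on $X_B$ by homeomorphisms of bounded type. Moreover, the action $M\curvearrowright X_B$ is topologically regular: every $g\in M$ that fixes a point $x\in X_B$ fixes a neighbourhood of $x$ pointwise; equivalently, all isotropy groups of the groupoid of germs of the action are trivial. -/

import Mathlib

open Set Filter Topology

noncomputable section

/-! ### Group actions: topological regularity, germs, stability systems -/

/-- A point `y` is topologically regular if every group element that fixes `y` fixes a
neighbourhood of `y` pointwise. -/
def IsTopologicallyRegularPoint (G : Type*) {Y : Type*} [Group G] [TopologicalSpace Y]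
    [MulAction G Y] (y : Y) : Prop :=
  ∀ g : G, g • y = y → ∀ᶠ z in 𝓝 y, g • z = z

/-- An action is topologically regular if every point is. -/
def IsTopologicallyRegular (G Y : Type*) [Group G] [TopologicalSpace Y] [MulAction G Y] : Prop :=
  ∀ y : Y, IsTopologicallyRegularPoint G y

/-- Two group elements which both send `x` to `y` are equivalent when they have the same germ at
`x`, that is, when they agree on a neighbourhood of `x`. -/
def germSetoid (G : Type*) {Y : Type*} [Group G] [TopologicalSpace Y] [MulAction G Y] (x y : Y) :
    Setoid {g : G // g • x = y} where
  r g h := ∀ᶠ z in 𝓝 x, g.1 • z = h.1 • z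
  iseqv :=
    { refl := fun _ => Eventually.of_forall fun _ => rfl
      symm := fun h => h.mono fun _ hz => hz.symm
      trans := fun h₁ h₂ => (h₁.and h₂).mono fun _ hz => hz.1.trans hz.2 }

/-- The objects of the groupoid of germs: the points of the space. -/
@[ext]
structure GermGroupoid (G Y : Type*) [Group G] [TopologicalSpace Y] [MulAction G Y] where
  pt : Y

/-- The groupoid of germs of an action, presented as a category: the arrows from `x` to `y` are
the germs at `x` of the group elements sending `x` to `y`. -/
instance (G Y : Type*) [Group G] [TopologicalSpace Y] [MulAction G Y] [ContinuousConstSMul G Y] :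
    CategoryTheory.Groupoid (GermGroupoid G Y) where
  Hom x y := Quotient (germSetoid G x.pt y.pt)
  id x := Quotient.mk (germSetoid G x.pt x.pt) ⟨1, one_smul G x.pt⟩
  comp {x y z} := Quotient.map₂ (sa := germSetoid G x.pt y.pt) (sb := germSetoid G y.pt z.pt)
    (sc := germSetoid G x.pt z.pt)
    (fun a b => ⟨b.1 * a.1, by rw [mul_smul, a.2, b.2]⟩) (by
      intro a a' ha b b' hb
      have hc : Tendsto (fun w : Y => a.1 • w) (𝓝 x.pt) (𝓝 y.pt) := by
        have := (continuous_const_smul (T := Y) a.1).tendsto x.pt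
        rwa [a.2] at this
      filter_upwards [ha, hc.eventually hb] with w h₁ h₂
      rw [mul_smul, mul_smul, h₂, h₁])
  inv {x y} := Quotient.map (sa := germSetoid G x.pt y.pt) (sb := germSetoid G y.pt x.pt)
    (fun a => ⟨a.1⁻¹, by rw [inv_smul_eq_iff, a.2]⟩) (by
      intro a a' ha
      have hc : Tendsto (fun w : Y => a.1⁻¹ • w) (𝓝 y.pt) (𝓝 x.pt) := by
        have := (continuous_const_smul (T := Y) a.1⁻¹).tendsto y.pt
        rwa [show a.1⁻¹ • y.pt = x.pt by rw [inv_smul_eq_iff, a.2]] at this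
      filter_upwards [hc.eventually ha] with w h₁
      show a.1⁻¹ • w = a'.1⁻¹ • w
      rw [eq_inv_smul_iff, ← h₁, smul_inv_smul])
  id_comp := by
    rintro x y ⟨a⟩
    exact congrArg (Quotient.mk _) (Subtype.ext (mul_one _))
  comp_id := by
    rintro x y ⟨a⟩
    exact congrArg (Quotient.mk _) (Subtype.ext (one_mul _))
  assoc := by
    rintro x y z w ⟨a⟩ ⟨b⟩ ⟨c⟩
    exact congrArg (Quotient.mk _) (Subtype.ext (mul_assoc _ _ _).symm)
  inv_comp := by
    rintro x y ⟨a⟩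
    exact congrArg (Quotient.mk _) (Subtype.ext (mul_inv_cancel _))
  comp_inv := by
    rintro x y ⟨a⟩
    exact congrArg (Quotient.mk _) (Subtype.ext (inv_mul_cancel _))

/-- The isotropy group at `x` of the groupoid of germs: the group of all arrows from `x` to `x`. -/
abbrev GermIsotropy (G : Type*) {Y : Type*} [Group G] [TopologicalSpace Y] [MulAction G Y]
    [ContinuousConstSMul G Y] (x : Y) : Type _ :=
  CategoryTheory.Aut (GermGroupoid.mk x : GermGroupoid G Y)

open Classical in
/-- The Chabauty topology on the set of subgroups of a discrete group: the topology induced by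
the product topology on `{0,1}^G`. -/
instance chabautyTopology (G : Type*) [Group G] : TopologicalSpace (Subgroup G) :=
  TopologicalSpace.induced (fun (H : Subgroup G) (g : G) => decide (g ∈ H)) inferInstance

/-- The conjugate `g H g⁻¹`. -/
def conjSubgroup {G : Type*} [Group G] (g : G) (H : Subgroup G) : Subgroup G :=
  H.map (MulAut.conj g).toMonoidHom

theorem conjSubgroup_one {G : Type*} [Group G] (H : Subgroup G) : conjSubgroup 1 H = H := by
  ext x
  simp [conjSubgroup]

theorem conjSubgroup_mul {G : Type*} [Group G] (g h : G) (H : Subgroup G) :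
    conjSubgroup (g * h) H = conjSubgroup g (conjSubgroup h H) := by
  unfold conjSubgroup
  rw [Subgroup.map_map]
  congr 1
  ext x
  simp [mul_assoc]

theorem mem_conjSubgroup {G : Type*} [Group G] (g x : G) (H : Subgroup G) :
    x ∈ conjSubgroup g H ↔ g⁻¹ * x * g ∈ H := by
  constructor
  · rintro ⟨y, hy, rfl⟩
    simpa [mul_assoc] using hy
  · intro h
    exact ⟨_, h, by simp [mul_assoc]⟩

theorem continuous_conjSubgroup {G : Type*} [Group G] (g : G) :
    Continuous (conjSubgroup g : Subgroup G → Subgroup G) := by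
  classical
  refine continuous_induced_rng.2 (continuous_pi fun x => ?_)
  have h : Continuous ((fun f : G → Bool => f (g⁻¹ * x * g)) ∘
      fun (H : Subgroup G) (y : G) => @decide (y ∈ H) (Classical.propDecidable _)) :=
    (continuous_apply (g⁻¹ * x * g)).comp continuous_induced_dom
  refine h.congr fun H => ?_
  simp [mem_conjSubgroup]

/-- The closure of the set of stabilisers of those points at which the stabiliser map
`Y → Sub(G)` is continuous. -/
def stabilitySet (G Y : Type*) [Group G] [TopologicalSpace Y] [MulAction G Y] :
    Set (Subgroup G) :=
  closure (MulAction.stabilizer G '' {y : Y | ContinuousAt (fun z : Y => MulAction.stabilizer G z) y})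

theorem conjSubgroup_mem_stabilitySet {G Y : Type*} [Group G] [TopologicalSpace Y] [MulAction G Y]
    [ContinuousConstSMul G Y] (g : G) {H : Subgroup G} (hH : H ∈ stabilitySet G Y) :
    conjSubgroup g H ∈ stabilitySet G Y := by
  refine map_mem_closure (continuous_conjSubgroup g) hH ?_
  rintro _ ⟨y, hy, rfl⟩
  refine ⟨g • y, ?_, MulAction.stabilizer_smul_eq_stabilizer_map_conj g y⟩
  have h1 : (fun z : Y => MulAction.stabilizer G z) =
      fun z : Y => conjSubgroup g (MulAction.stabilizer G (g⁻¹ • z)) := by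
    funext z
    have := MulAction.stabilizer_smul_eq_stabilizer_map_conj g (g⁻¹ • z)
    rwa [smul_inv_smul] at this
  show ContinuousAt (fun z : Y => MulAction.stabilizer G z) (g • y)
  rw [h1]
  refine (continuous_conjSubgroup g).continuousAt.comp ?_
  refine ContinuousAt.comp (g := fun z : Y => MulAction.stabilizer G z) ?_
    (continuous_const_smul g⁻¹).continuousAt
  rw [inv_smul_smul]
  exact hy

/-- The stability system of `G ↷ Y`, with the topology induced by the Chabauty topology. -/
abbrev StabilitySystem (G Y : Type*) [Group G] [TopologicalSpace Y] [MulAction G Y] : Type _ :=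
  {H : Subgroup G // H ∈ stabilitySet G Y}

/-- `G` acts on its stability system by conjugation. -/
instance (G Y : Type*) [Group G] [TopologicalSpace Y] [MulAction G Y] [ContinuousConstSMul G Y] :
    MulAction G (StabilitySystem G Y) where
  smul g H := ⟨conjSubgroup g H.1, conjSubgroup_mem_stabilitySet g H.2⟩
  one_smul H := Subtype.ext (conjSubgroup_one H.1)
  mul_smul g h H := Subtype.ext (conjSubgroup_mul g h H.1)

instance (G Y : Type*) [Group G] [TopologicalSpace Y] [MulAction G Y] [ContinuousConstSMul G Y] :
    ContinuousConstSMul G (StabilitySystem G Y) where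
  continuous_const_smul g :=
    Continuous.subtype_mk ((continuous_conjSubgroup g).comp continuous_subtype_val) _

/-! ### The rooted tree and the mother group -/

/-- The automorphism group of the `d`-regular rooted tree, whose vertices are the finite words
over `{0, …, d-1}`, a word being an ancestor of another one when it is a prefix of it. -/
def treeAut (d : ℕ) : Subgroup (Equiv.Perm (List (Fin d))) where
  carrier := {g | (∀ v, (g v).length = v.length) ∧ ∀ u v, u <+: v ↔ g u <+: g v}
  one_mem' := ⟨fun _ => rfl, fun _ _ => Iff.rfl⟩
  mul_mem' := fun {g h} hg hh =>
    ⟨fun v => (hg.1 (h v)).trans (hh.1 v), fun u v => (hh.2 u v).trans (hg.2 (h u) (h v))⟩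
  inv_mem' := fun {g} hg => by
    have hinv : ∀ v, g (g⁻¹ v) = v := fun v => Equiv.apply_symm_apply g v
    refine ⟨fun v => ?_, fun u v => ?_⟩
    · rw [← hg.1 (g⁻¹ v), hinv]
    · rw [hg.2 (g⁻¹ u) (g⁻¹ v), hinv, hinv]

/-- The permutation `σ` of the alphabet, acting on the first letter of a word. -/
def permFirst {d : ℕ} (σ : Equiv.Perm (Fin d)) : List (Fin d) → List (Fin d)
  | [] => []
  | x :: w => σ x :: w

/-- The automorphism permuting the first level by `σ`, with trivial sections. -/
def rooted {d : ℕ} (σ : Equiv.Perm (Fin d)) : treeAut d :=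
  ⟨{ toFun := permFirst σ
     invFun := permFirst σ⁻¹
     left_inv := by rintro (_ | ⟨x, w⟩) <;> simp [permFirst]
     right_inv := by rintro (_ | ⟨x, w⟩) <;> simp [permFirst] },
   by rintro (_ | ⟨x, w⟩) <;> simp [permFirst],
   by rintro (_ | ⟨x, w⟩) (_ | ⟨y, v⟩) <;> simp [permFirst, List.cons_prefix_cons]⟩

/-- `g = (s 0, …, s (d-1)) ρ`: the automorphism `g` permutes the first level by `ρ`, and its
section at the letter `x` is `s x`. -/
def HasWreathRecursion {d : ℕ} (g : treeAut d) (s : Fin d → treeAut d)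
    (ρ : Equiv.Perm (Fin d)) : Prop :=
  ∀ (x : Fin d) (w : List (Fin d)), g.1 (x :: w) = ρ x :: (s x).1 w

/-- The alternating group acting on the first level, with trivial sections. -/
def motherA (d : ℕ) : Set (treeAut d) :=
  {g | ∃ ρ ∈ alternatingGroup (Fin d), HasWreathRecursion g (fun _ => 1) ρ}

/-- The automorphisms with a wreath recursion `g = (g, σ 1, …, σ (d-1)) ρ`, where
`σ 1, …, σ (d-1), ρ` are alternating permutations and `ρ` fixes `0`. -/
def motherB (d : ℕ) [NeZero d] : Set (treeAut d) :=
  {g | ∃ (σ : Fin d → Equiv.Perm (Fin d)) (ρ : Equiv.Perm (Fin d)),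
    (∀ x, σ x ∈ alternatingGroup (Fin d)) ∧ ρ ∈ alternatingGroup (Fin d) ∧ ρ 0 = 0 ∧
    HasWreathRecursion g (fun x => if x = 0 then g else rooted (σ x)) ρ}

/-- The alternating mother group over `d` elements. -/
def motherGroup (d : ℕ) [NeZero d] : Subgroup (treeAut d) :=
  Subgroup.closure (motherA d ∪ motherB d)

/-- The boundary of the tree: infinite words, with the product topology. -/
abbrev TreeBoundary (d : ℕ) : Type := ℕ → Fin d

/-- The prefix of length `n` of a ray. -/
def TreeBoundary.pre {d : ℕ} (γ : TreeBoundary d) (n : ℕ) : List (Fin d) :=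
  List.ofFn fun i : Fin n => γ i

theorem TreeBoundary.length_map_pre {d : ℕ} (g : treeAut d) (γ : TreeBoundary d) (n : ℕ) :
    (g.1 (γ.pre n)).length = n := by
  rw [g.2.1, TreeBoundary.pre, List.length_ofFn]

/-- The image of the ray `γ` under the tree automorphism `g`; its `n`-th letter is the `n`-th
letter of the image of any long enough prefix of `γ`. -/
def TreeBoundary.map {d : ℕ} (g : treeAut d) (γ : TreeBoundary d) : TreeBoundary d :=
  fun n => (g.1 (γ.pre (n + 1)))[n]'(by rw [TreeBoundary.length_map_pre]; exact n.lt_succ_self)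

theorem TreeBoundary.pre_prefix {d : ℕ} (γ : TreeBoundary d) {m n : ℕ} (h : m ≤ n) :
    γ.pre m <+: γ.pre n := by
  rw [List.prefix_iff_getElem]
  refine ⟨by simpa [TreeBoundary.pre] using h, fun i hi => ?_⟩
  simp [TreeBoundary.pre]

theorem TreeBoundary.pre_map {d : ℕ} (g : treeAut d) (γ : TreeBoundary d) (n : ℕ) :
    (TreeBoundary.map g γ).pre n = g.1 (γ.pre n) := by
  apply List.ext_getElem
  · rw [TreeBoundary.length_map_pre, TreeBoundary.pre, List.length_ofFn]
  · intro i h₁ h₂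
    have hi : i < n := by simpa [TreeBoundary.pre] using h₁
    have hp := (g.2.2 _ _).1 (γ.pre_prefix (Nat.succ_le_of_lt hi))
    have h₃ : ((TreeBoundary.map g γ).pre n)[i]'h₁ = TreeBoundary.map g γ i := by
      simp [TreeBoundary.pre]
    rw [h₃]
    exact hp.getElem _

theorem TreeBoundary.ext_pre {d : ℕ} {γ η : TreeBoundary d} (h : ∀ n, γ.pre n = η.pre n) :
    γ = η := by
  funext n
  exact congrFun (List.ofFn_injective (h (n + 1))) (Fin.last n)

instance (d : ℕ) : MulAction (treeAut d) (TreeBoundary d) where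
  smul g γ := TreeBoundary.map g γ
  one_smul γ := TreeBoundary.ext_pre fun n => TreeBoundary.pre_map 1 γ n
  mul_smul g h γ := TreeBoundary.ext_pre fun n => by
    show (TreeBoundary.map (g * h) γ).pre n = (TreeBoundary.map g (TreeBoundary.map h γ)).pre n
    rw [TreeBoundary.pre_map, TreeBoundary.pre_map, TreeBoundary.pre_map]
    rfl

instance (d : ℕ) : ContinuousConstSMul (treeAut d) (TreeBoundary d) where
  continuous_const_smul g := by
    refine continuous_pi fun n => ?_
    have h : Continuous fun (γ : TreeBoundary d) (i : Fin (n + 1)) => (γ : ℕ → Fin d) i :=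
      continuous_pi fun i => continuous_apply (A := fun _ : ℕ => Fin d) (i : ℕ)
    exact (continuous_of_discreteTopology (f := fun u : Fin (n + 1) → Fin d =>
      (g.1 (List.ofFn u))[n]'(by rw [g.2.1, List.length_ofFn]; exact n.lt_succ_self))).comp h

instance (d : ℕ) [NeZero d] : ContinuousConstSMul (motherGroup d) (TreeBoundary d) where
  continuous_const_smul g := continuous_const_smul (g : treeAut d)

/-- The Schreier dynamical system of the mother group: the stability system of its action on the
boundary of the tree. -/
abbrev SchreierSystem (d : ℕ) [NeZero d] : Type :=
  StabilitySystem (motherGroup d) (TreeBoundary d)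

/-! ### Bratteli diagrams -/

/-- A Bratteli diagram: vertex levels `V n`, edges `E n` from `V n` to `V (n + 1)`, all of them
finite, a single top vertex, and (as usual) no sinks and no sources other than the top vertex. -/
structure BratteliDiagram where
  V : ℕ → Type
  E : ℕ → Type
  finite_V : ∀ n, Finite (V n)
  finite_E : ∀ n, Finite (E n)
  o : ∀ {n}, E n → V n
  t : ∀ {n}, E n → V (n + 1)
  top : V 0
  eq_top : ∀ v : V 0, v = top
  exists_o_eq : ∀ {n} (v : V n), ∃ e : E n, o e = v
  exists_t_eq : ∀ {n} (v : V (n + 1)), ∃ e : E n, t e = v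

namespace BratteliDiagram

/-- A diagram is stationary if the levels `V 1, V 2, …` can be identified with one set in such a
way that the number of edges from `u` to `v` is the same between any two consecutive ones of
these levels. -/
def IsStationary (B : BratteliDiagram) : Prop :=
  ∃ (W : Type) (c : ∀ n, W ≃ B.V (n + 1)), ∀ (n : ℕ) (u v : W),
    Nat.card {e : B.E (n + 1) // B.o e = c n u ∧ B.t e = c (n + 1) v} =
      Nat.card {e : B.E 1 // B.o e = c 0 u ∧ B.t e = c 1 v}

/-- `B.Reaches v m w`: there is a directed path from the vertex `v` to the vertex `w` of
level `m`. -/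
inductive Reaches (B : BratteliDiagram) {n : ℕ} (v : B.V n) : ∀ m : ℕ, B.V m → Prop
  | refl : Reaches B v n v
  | step {m : ℕ} (e : B.E m) (h : Reaches B v m (B.o e)) : Reaches B v (m + 1) (B.t e)

/-- A diagram is simple if for every vertex `v` there is a later level all of whose vertices can
be reached from `v`. -/
def IsSimple (B : BratteliDiagram) : Prop :=
  ∀ (n : ℕ) (v : B.V n), ∃ m > n, ∀ w : B.V m, B.Reaches v m w

instance (B : BratteliDiagram) (n : ℕ) : TopologicalSpace (B.E n) := ⊥

instance (B : BratteliDiagram) (n : ℕ) : DiscreteTopology (B.E n) := ⟨rfl⟩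

/-- The path space: the infinite directed paths starting at the top vertex. -/
@[ext]
structure PathSpace (B : BratteliDiagram) where
  edge : ∀ n, B.E n
  compat : ∀ n, B.t (edge n) = B.o (edge (n + 1))

/-- The topology of the path space is induced by the product of the discrete topologies. -/
instance (B : BratteliDiagram) : TopologicalSpace B.PathSpace :=
  TopologicalSpace.induced PathSpace.edge inferInstance

theorem PathSpace.continuous_edge (B : BratteliDiagram) (i : ℕ) :
    Continuous fun x : B.PathSpace => x.edge i :=
  (continuous_apply i).comp continuous_induced_dom

/-- The finite paths `f_0 f_1 ⋯ f_n` starting at the top vertex. -/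
structure FinPath (B : BratteliDiagram) (n : ℕ) where
  edge : ∀ i, i ≤ n → B.E i
  compat : ∀ (i : ℕ) (h : i < n), B.t (edge i h.le) = B.o (edge (i + 1) h)

/-- The end vertex `t(γ)` of a finite path. -/
def FinPath.target {B : BratteliDiagram} {n : ℕ} (γ : B.FinPath n) : B.V (n + 1) :=
  B.t (γ.edge n le_rfl)

/-- The cylinder `C_γ` of infinite paths starting with `γ`. -/
def cylinder {B : BratteliDiagram} {n : ℕ} (γ : B.FinPath n) : Set B.PathSpace :=
  {x | ∀ (i : ℕ) (h : i ≤ n), x.edge i = γ.edge i h}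

theorem o_of_mem_cylinder {B : BratteliDiagram} {n : ℕ} {γ : B.FinPath n} {x : B.PathSpace}
    (hx : x ∈ cylinder γ) : B.o (x.edge (n + 1)) = γ.target := by
  rw [← x.compat n, hx n le_rfl]
  rfl

theorem isOpen_cylinder {B : BratteliDiagram} {n : ℕ} (γ : B.FinPath n) :
    IsOpen (cylinder γ) := by
  have : cylinder γ = ⋂ i ∈ Set.Iic n, {x : B.PathSpace | ∀ h : i ≤ n, x.edge i = γ.edge i h} := by
    ext x
    simp only [cylinder, Set.mem_ofPred_eq, Set.mem_iInter, Set.mem_Iic]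
    exact ⟨fun h i _ => h i, fun h i hi => h i hi hi⟩
  rw [this]
  refine (Set.finite_Iic n).isOpen_biInter fun i _ => ?_
  exact (isOpen_discrete {e : B.E i | ∀ h : i ≤ n, e = γ.edge i h}).preimage
    (PathSpace.continuous_edge B i)

/-- The infinite path obtained from `x` by replacing its first edges by the finite path `γ`. -/
def graft {B : BratteliDiagram} {n : ℕ} (γ : B.FinPath n) (x : B.PathSpace)
    (hx : B.o (x.edge (n + 1)) = γ.target) : B.PathSpace :=
  ⟨fun i => if h : i ≤ n then γ.edge i h else x.edge i, by
    intro i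
    rcases lt_trichotomy i n with h | h | h
    · rw [dif_pos h.le, dif_pos (Nat.succ_le_of_lt h)]
      exact γ.compat i h
    · subst h
      rw [dif_pos le_rfl, dif_neg (Nat.not_succ_le_self i)]
      exact hx.symm
    · rw [dif_neg (by omega), dif_neg (by omega)]
      exact x.compat i⟩

open Classical in
/-- The map `γ e_{n+1} e_{n+2} ⋯ ↦ γ' e_{n+1} e_{n+2} ⋯` on the paths where it makes sense, and
the identity elsewhere. -/
def swap {B : BratteliDiagram} {n : ℕ} (γ' : B.FinPath n) (x : B.PathSpace) : B.PathSpace :=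
  if hx : B.o (x.edge (n + 1)) = γ'.target then graft γ' x hx else x

theorem swap_of_mem {B : BratteliDiagram} {n : ℕ} {γ γ' : B.FinPath n}
    (h : γ.target = γ'.target) {x : B.PathSpace} (hx : x ∈ cylinder γ) :
    swap γ' x = graft γ' x ((o_of_mem_cylinder hx).trans h) :=
  dif_pos _

theorem swap_mem {B : BratteliDiagram} {n : ℕ} {γ γ' : B.FinPath n}
    (h : γ.target = γ'.target) {x : B.PathSpace} (hx : x ∈ cylinder γ) :
    swap γ' x ∈ cylinder γ' := by
  rw [swap_of_mem h hx]
  intro i hi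
  exact dif_pos hi

theorem swap_swap {B : BratteliDiagram} {n : ℕ} {γ γ' : B.FinPath n}
    (h : γ.target = γ'.target) {x : B.PathSpace} (hx : x ∈ cylinder γ) :
    swap γ (swap γ' x) = x := by
  rw [swap_of_mem h.symm (swap_mem h hx)]
  refine PathSpace.ext (funext fun i => ?_)
  by_cases hi : i ≤ n
  · exact (dif_pos hi).trans (hx i hi).symm
  · refine (dif_neg hi).trans ?_
    rw [swap_of_mem h hx]
    exact dif_neg hi

theorem continuousOn_swap {B : BratteliDiagram} {n : ℕ} {γ γ' : B.FinPath n}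
    (h : γ.target = γ'.target) : ContinuousOn (swap γ') (cylinder γ) := by
  rw [continuousOn_iff_continuous_domRestrict]
  refine continuous_induced_rng.2 (continuous_pi fun i => ?_)
  by_cases hi : i ≤ n
  · have : (fun x : cylinder γ => (swap γ' x.1).edge i) = fun _ => γ'.edge i hi := by
      funext x
      exact swap_mem h x.2 i hi
    exact this ▸ continuous_const
  · have : (fun x : cylinder γ => (swap γ' x.1).edge i) = fun x => x.1.edge i := by
      funext x
      rw [swap_of_mem h x.2]
      exact dif_neg hi
    exact this ▸ ((PathSpace.continuous_edge B i).comp continuous_subtype_val)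

/-- The partial homeomorphism `τ_{γ,γ'}` with domain `C_γ` and range `C_γ'`, which replaces the
beginning `γ` of a path by `γ'`; here `γ` and `γ'` have the same end vertex. -/
def tau {B : BratteliDiagram} {n : ℕ} (γ γ' : B.FinPath n) (h : γ.target = γ'.target) :
    OpenPartialHomeomorph B.PathSpace B.PathSpace where
  toFun := swap γ'
  invFun := swap γ
  source := cylinder γ
  target := cylinder γ'
  map_source' _ hx := swap_mem h hx
  map_target' _ hx := swap_mem h.symm hx
  left_inv' _ hx := swap_swap h hx
  right_inv' _ hx := swap_swap h.symm hx
  continuousOn_toFun := continuousOn_swap h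
  continuousOn_invFun := continuousOn_swap h.symm
  open_source := isOpen_cylinder γ
  open_target := isOpen_cylinder γ'

/-- The pseudogroup generated by the partial homeomorphisms `τ_{γ,γ'}`: the smallest one that
contains them. -/
def tailPseudogroup (B : BratteliDiagram) : StructureGroupoid B.PathSpace :=
  sInf {F | ClosedUnderRestriction F ∧
    ∀ (n : ℕ) (γ γ' : B.FinPath n) (h : γ.target = γ'.target), tau γ γ' h ∈ F}

/-- The germ of `g` at `x` belongs to the tail groupoid, that is, it is the germ at `x` of an
element of the tail pseudogroup. -/
def GermInTail (B : BratteliDiagram) (g : B.PathSpace ≃ₜ B.PathSpace) (x : B.PathSpace) : Prop :=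
  ∃ τ ∈ B.tailPseudogroup, x ∈ τ.source ∧ ∀ᶠ y in 𝓝 x, g y = τ y

/-- A homeomorphism of the path space is of bounded type if the number of cylinders `C_γ` in the
tower of `v` on which it is not equal to some `τ_{γ,γ'}` is bounded uniformly in the vertex `v`,
and if all but finitely many of its germs belong to the tail groupoid. -/
def IsBoundedType (B : BratteliDiagram) (g : B.PathSpace ≃ₜ B.PathSpace) : Prop :=
  (∃ K : ℕ, ∀ (n : ℕ) (v : B.V (n + 1)),
    {γ : B.FinPath n | γ.target = v ∧
      ¬ ∃ (γ' : B.FinPath n) (h : γ.target = γ'.target),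
        EqOn g (tau γ γ' h) (cylinder γ)}.encard ≤ (K : ℕ∞)) ∧
  {x | ¬ B.GermInTail g x}.Finite

end BratteliDiagram

end

/-! A directed element `b = (b, σ 1, …, σ (d-1)) ρ` sends the ray `0ⁿ x a w`, with `x ≠ 0`, to `0ⁿ
(ρ x) (σ x a) w`. It fixes `0^∞`, but near that ray it acts through the pair `(x, a)`, the pointer,
in the same way at every depth `n`. So the stabilisers of `0ⁿ x a w` accumulate at different
subgroups for different pointers, and this is the only obstruction to continuity: it occurs at the
rays that are eventually `0`.

The remedy is to replace each such ray by one point for every pointer. A point of `BlowUp` records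
for each suffix of a ray whether it starts with `0`, and its pointer; for the suffix `0^∞` the
pointer is free, but constant along the zeros. On this compact space `b` fixes a point exactly when
it fixes its pointer (`act_eq_self`, `ptr_of_act_eq_self`), and the pointer is locally constant.
Every element of the mother group lifts to a map that near each point is a change of prefix followed
by a directed element (`LocAt`). Such a lift is determined by its projection (`LocAt.eq_of_proj`),
so the lifts form an action, which is topologically regular (`LocAt.eventually_eq_self`). Hence the
stabiliser map of the blow-up is continuous.

The rays that are not eventually `0` have a single preimage each, and these preimages are dense.
Comparing limits along them identifies the Schreier system with the set of stabilisers of points of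
the blow-up (`stabilitySet_eq_range`). Distinct points have distinct stabilisers by a branching
argument: since the alternating group is perfect for `5 ≤ d`, the mother group contains copies of
suitable directed elements acting below a single vertex (`below_mem_branchGroup`). By compactness
the blow-up is the Schreier system.

A state is determined by the next state and a letter, so the blow-up is the path space of a
stationary diagram. Each lift has a bounded number of nontrivial sections per level, which gives
bounded type. -/

namespace MotherGroup

noncomputable section

/-! ### The space that separates the germs at eventually zero rays, with its directed maps. -/

section BlowUp

variable {d : ℕ} [NeZero d]

/-! ### The blow-up of the boundary -/

/-- A pointer: a nonzero letter together with the letter that follows it. -/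
abbrev Pointer (d : ℕ) [NeZero d] : Type := {x : Fin d // x ≠ 0} × Fin d

/-- The state of a ray: whether its first letter is `0`, and its first nonzero letter together with
the letter after it. -/
abbrev State (d : ℕ) [NeZero d] : Type := Bool × Pointer d

/-- The first letter of a ray in the state `s`. -/
def letter (s : State d) : Fin d := if s.1 then 0 else s.2.1

/-- The state of the ray obtained by putting the letter `c` in front of a ray in the state `s`. -/
def prev (c : Fin d) (s : State d) : State d :=
  if h : c = 0 then (true, s.2) else (false, ⟨c, h⟩, letter s)

@[simp] theorem letter_prev (c : Fin d) (s : State d) : letter (prev c s) = c := by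
  by_cases h : c = 0 <;> simp [prev, letter, h]

@[simp] theorem prev_zero (s : State d) : prev 0 s = (true, s.2) := by simp [prev]

theorem prev_of_ne {c : Fin d} (h : c ≠ 0) (s : State d) :
    prev c s = (false, ⟨c, h⟩, letter s) := by simp [prev, h]

/-- The boundary of the tree with each ray that is eventually `0` replaced by one point for each
pointer: the sequences of states, each of which determines the previous one up to its letter. -/
abbrev BlowUp (d : ℕ) [NeZero d] : Type :=
  {s : ℕ → State d // ∀ n, s n = prev (letter (s n)) (s (n + 1))}

/-- There are finitely many states, and each relation is a closed condition on two consecutive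
coordinates. Compactness makes `proj` a closed map and turns the final continuous bijection into a
homeomorphism. -/
instance : CompactSpace (BlowUp d) := by
  have hp : Continuous fun p : State d × State d => prev (letter p.1) p.2 :=
    continuous_of_discreteTopology
  have h : IsClosed {s : ℕ → State d | ∀ n, s n = prev (letter (s n)) (s (n + 1))} := by
    have h2 : ∀ n, Continuous fun s : ℕ → State d => (s n, s (n + 1)) := fun n =>
      (continuous_apply n).prodMk (continuous_apply (n + 1))
    simp only [Set.ofPred_forall]
    exact isClosed_iInter fun n => isClosed_eq (continuous_apply n) (hp.comp (h2 n))
  exact isCompact_iff_compactSpace.1 h.isCompact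

theorem continuous_state (n : ℕ) : Continuous fun ξ : BlowUp d => ξ.1 n :=
  (continuous_apply n).comp continuous_subtype_val

theorem isOpen_state_eq (n : ℕ) (s : State d) : IsOpen {ξ : BlowUp d | ξ.1 n = s} :=
  (isOpen_discrete {s}).preimage (continuous_state n)

/-- Putting a letter in front of a point of the blow-up. -/
def cons (c : Fin d) (ξ : BlowUp d) : BlowUp d :=
  ⟨fun | 0 => prev c (ξ.1 0) | n + 1 => ξ.1 n, by
    rintro (_ | n)
    · simp
    · exact ξ.2 n⟩

/-- Removing the first letter. -/
def tail (ξ : BlowUp d) : BlowUp d := ⟨fun n => ξ.1 (n + 1), fun n => ξ.2 (n + 1)⟩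

/-- The first letter. -/
def head (ξ : BlowUp d) : Fin d := letter (ξ.1 0)

@[simp] theorem cons_zero (c : Fin d) (ξ : BlowUp d) : (cons c ξ).1 0 = prev c (ξ.1 0) := rfl

@[simp] theorem cons_succ (c : Fin d) (ξ : BlowUp d) (n : ℕ) : (cons c ξ).1 (n + 1) = ξ.1 n := rfl

@[simp] theorem tail_val (ξ : BlowUp d) (n : ℕ) : (tail ξ).1 n = ξ.1 (n + 1) := rfl

@[simp] theorem head_cons (c : Fin d) (ξ : BlowUp d) : head (cons c ξ) = c := letter_prev _ _

@[simp] theorem tail_cons (c : Fin d) (ξ : BlowUp d) : tail (cons c ξ) = ξ := rfl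

theorem BlowUp.ext {ξ η : BlowUp d} (h : ∀ n, ξ.1 n = η.1 n) : ξ = η := Subtype.ext (funext h)

@[simp] theorem cons_head_tail (ξ : BlowUp d) : cons (head ξ) (tail ξ) = ξ := by
  refine BlowUp.ext ?_
  rintro (_ | n)
  · exact (ξ.2 0).symm
  · rfl

theorem continuous_cons (c : Fin d) : Continuous (cons c : BlowUp d → BlowUp d) := by
  refine Continuous.subtype_mk (continuous_pi ?_) _
  rintro (_ | n)
  · exact (continuous_of_discreteTopology (f := prev c)).comp (continuous_state 0)
  · exact continuous_state n

theorem continuous_tail : Continuous (tail : BlowUp d → BlowUp d) :=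
  Continuous.subtype_mk (continuous_pi fun n => continuous_state (n + 1)) _

theorem continuous_head : Continuous (head : BlowUp d → Fin d) :=
  (continuous_of_discreteTopology (f := letter)).comp (continuous_state 0)

/-- Putting a word in front of a point of the blow-up. -/
def app : List (Fin d) → BlowUp d → BlowUp d
  | [], ξ => ξ
  | c :: w, ξ => cons c (app w ξ)

/-- The word formed by the first `n` letters. -/
def take : ℕ → BlowUp d → List (Fin d)
  | 0, _ => []
  | n + 1, ξ => head ξ :: take n (tail ξ)

/-- Removing the first `n` letters. -/
def drop : ℕ → BlowUp d → BlowUp d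
  | 0, ξ => ξ
  | n + 1, ξ => drop n (tail ξ)

@[simp] theorem length_take (n : ℕ) (ξ : BlowUp d) : (take n ξ).length = n := by
  induction n generalizing ξ with
  | zero => rfl
  | succ n ih => simp [take, ih]

@[simp] theorem app_take_drop (n : ℕ) (ξ : BlowUp d) : app (take n ξ) (drop n ξ) = ξ := by
  induction n generalizing ξ with
  | zero => rfl
  | succ n ih => simp [take, drop, app, ih]

theorem app_append (v w : List (Fin d)) (ξ : BlowUp d) : app (v ++ w) ξ = app v (app w ξ) := by
  induction v with
  | nil => rfl
  | cons c v ih => simp [app, ih]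

theorem take_app_add (w : List (Fin d)) (n : ℕ) (ξ : BlowUp d) :
    take (w.length + n) (app w ξ) = w ++ take n ξ := by
  induction w with
  | nil => simp [app]
  | cons c w ih =>
    rw [List.length_cons, Nat.add_right_comm]
    simp [app, take, ih]

theorem take_app {w : List (Fin d)} {n : ℕ} (h : w.length = n) (ξ : BlowUp d) :
    take n (app w ξ) = w := by
  subst h
  simpa [take] using take_app_add w 0 ξ

theorem drop_app {w : List (Fin d)} {n : ℕ} (h : w.length = n) (ξ : BlowUp d) :
    drop n (app w ξ) = ξ := by
  subst h
  induction w with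
  | nil => rfl
  | cons c w ih => simpa [app, drop] using ih

@[simp] theorem drop_val (n k : ℕ) (ξ : BlowUp d) : (drop n ξ).1 k = ξ.1 (n + k) := by
  induction n generalizing ξ with
  | zero => simp [drop]
  | succ n ih => rw [drop, ih, tail_val, Nat.add_right_comm]

theorem app_injective (w : List (Fin d)) : Function.Injective (app w : BlowUp d → BlowUp d) :=
  fun ξ η h => by rw [← drop_app rfl ξ, h, drop_app rfl]

theorem continuous_app (w : List (Fin d)) : Continuous (app w : BlowUp d → BlowUp d) := by
  induction w with
  | nil => exact continuous_id
  | cons c w ih => exact (continuous_cons c).comp ih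

theorem continuous_drop (n : ℕ) : Continuous (drop n : BlowUp d → BlowUp d) := by
  induction n with
  | zero => exact continuous_id
  | succ n ih => exact ih.comp continuous_tail

theorem isOpen_take_eq (n : ℕ) (w : List (Fin d)) : IsOpen {ξ : BlowUp d | take n ξ = w} := by
  induction n generalizing w with
  | zero => exact isOpen_const (X := BlowUp d) (p := [] = w)
  | succ n ih =>
    cases w with
    | nil => simp [take]
    | cons c w =>
      simp only [take, List.cons.injEq]
      exact ((isOpen_discrete {c}).preimage continuous_head).inter
        ((ih w).preimage continuous_tail)

/-- The states up to position `n` are determined by the first `n` letters and the state at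
position `n`. -/
theorem state_eq_of_take {n : ℕ} {ξ η : BlowUp d} (h : take n ξ = take n η)
    (hs : ξ.1 n = η.1 n) : ∀ i ≤ n, ξ.1 i = η.1 i := by
  induction n generalizing ξ η with
  | zero =>
    intro i hi
    obtain rfl : i = 0 := by omega
    exact hs
  | succ n ih =>
    simp only [take, List.cons.injEq] at h
    have ht := ih (ξ := tail ξ) (η := tail η) h.2 hs
    rintro (_ | i) hi
    · rw [ξ.2 0, η.2 0]
      have h0 := ht 0 (Nat.zero_le _)
      have h1 := h.1
      simp only [tail_val, head] at h0 h1
      rw [h0, h1]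
    · exact ht i (by omega)

/-! ### The action of the directed elements -/

/-- Letting a permutation act on the first letter. -/
def rootAct (τ : Equiv.Perm (Fin d)) (ξ : BlowUp d) : BlowUp d := cons (τ (head ξ)) (tail ξ)

@[simp] theorem rootAct_cons (τ : Equiv.Perm (Fin d)) (c : Fin d) (ξ : BlowUp d) :
    rootAct τ (cons c ξ) = cons (τ c) ξ := by simp [rootAct]

theorem rootAct_rootAct (τ τ' : Equiv.Perm (Fin d)) (ξ : BlowUp d) :
    rootAct τ (rootAct τ' ξ) = rootAct (τ * τ') ξ := by
  simp [rootAct]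

@[simp] theorem rootAct_one (ξ : BlowUp d) : rootAct 1 ξ = ξ := by simp [rootAct]

theorem continuous_rootAct (τ : Equiv.Perm (Fin d)) :
    Continuous (rootAct τ : BlowUp d → BlowUp d) := by
  refine Continuous.subtype_mk (continuous_pi ?_) _
  rintro (_ | n)
  · exact (continuous_of_discreteTopology
      (f := fun p : State d × State d => prev (τ (letter p.1)) p.2)).comp
        ((continuous_state 0).prodMk (continuous_state 1))
  · exact continuous_state (n + 1)

/-- The permutation of the blow-up given by `rootAct`. -/
def rootPerm (τ : Equiv.Perm (Fin d)) : Equiv.Perm (BlowUp d) where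
  toFun := rootAct τ
  invFun := rootAct τ⁻¹
  left_inv ξ := by simp [rootAct_rootAct]
  right_inv ξ := by simp [rootAct_rootAct]

/-- The data of a directed automorphism `g = (g, σ 1, …, σ (d-1)) ρ`. -/
structure Directed (d : ℕ) [NeZero d] where
  -- Only the values at nonzero letters matter, the section at `0` being the element itself. Parity
  -- is not recorded, as lifting does not depend on it.
  σ : Fin d → Equiv.Perm (Fin d)
  ρ : Equiv.Perm (Fin d)
  map_zero : ρ 0 = 0

namespace Directed

theorem ρ_ne (b : Directed d) {x : Fin d} (h : x ≠ 0) : b.ρ x ≠ 0 := by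
  rw [← b.map_zero]
  exact b.ρ.injective.ne h

/-- The identity. -/
def one : Directed d := ⟨fun _ => 1, 1, rfl⟩

/-- The composition. -/
def mul (b c : Directed d) : Directed d :=
  ⟨fun x => b.σ (c.ρ x) * c.σ x, b.ρ * c.ρ, by simp [c.map_zero, b.map_zero]⟩

/-- The inverse. -/
def inv (b : Directed d) : Directed d :=
  ⟨fun x => (b.σ (b.ρ⁻¹ x))⁻¹, b.ρ⁻¹, by rw [Equiv.Perm.inv_eq_iff_eq, b.map_zero]⟩

/-- The action on the pointers. -/
def ptr (b : Directed d) (p : Pointer d) : Pointer d := (⟨b.ρ p.1, b.ρ_ne p.1.2⟩, b.σ p.1 p.2)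

/-- The states of the image of a point. -/
def actState (b : Directed d) : ℕ → BlowUp d → State d
  -- As `ρ` fixes `0`, a first letter stays zero or stays nonzero. The pointer is transformed
  -- directly, which also makes sense over `0^∞`.
  | 0, ξ => ((ξ.1 0).1, b.ptr (ξ.1 0).2)
  | n + 1, ξ => if head ξ = 0 then actState b n (tail ξ)
      else (rootAct (b.σ (head ξ)) (tail ξ)).1 n

theorem state_zero_of_head_eq {ξ : BlowUp d} (h : head ξ = 0) :
    ξ.1 0 = (true, (ξ.1 1).2) := by
  rw [ξ.2 0, show letter (ξ.1 0) = 0 from h, prev_zero]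

theorem state_zero_of_head_ne {ξ : BlowUp d} (h : head ξ ≠ 0) :
    ξ.1 0 = (false, ⟨head ξ, h⟩, head (tail ξ)) := by
  rw [ξ.2 0]
  exact prev_of_ne h _

/-- The action on the blow-up. -/
def act (b : Directed d) (ξ : BlowUp d) : BlowUp d :=
  ⟨fun n => b.actState n ξ, by
    intro n
    induction n generalizing ξ with
    | zero =>
      by_cases h : head ξ = 0
      · simp [actState, h, state_zero_of_head_eq h, letter]
      · have h1 := b.ρ_ne h
        simp only [actState, h, state_zero_of_head_ne h, if_false, ptr]
        rw [show letter (false, ((⟨b.ρ (head ξ), h1⟩, b.σ (head ξ) (head (tail ξ))) : Pointer d))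
          = b.ρ (head ξ) from rfl, prev_of_ne h1]
        simp [rootAct]
    | succ n ih =>
      by_cases h : head ξ = 0
      · simpa [actState, h] using ih (tail ξ)
      · simpa [actState, h] using (rootAct (b.σ (head ξ)) (tail ξ)).2 n⟩

@[simp] theorem act_zero (b : Directed d) (ξ : BlowUp d) :
    (b.act ξ).1 0 = ((ξ.1 0).1, b.ptr (ξ.1 0).2) := rfl

theorem act_cons_zero (b : Directed d) (ξ : BlowUp d) : b.act (cons 0 ξ) = cons 0 (b.act ξ) := by
  refine BlowUp.ext ?_
  rintro (_ | n)
  · simp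
  · simp [act, actState]

theorem act_cons_of_ne (b : Directed d) {x : Fin d} (h : x ≠ 0) (ξ : BlowUp d) :
    b.act (cons x ξ) = cons (b.ρ x) (rootAct (b.σ x) ξ) := by
  refine BlowUp.ext ?_
  rintro (_ | n)
  · simp [prev_of_ne h, prev_of_ne (b.ρ_ne h), ptr, rootAct]
    rfl
  · simp [act, actState, h]

theorem act_app_zero (b : Directed d) (n : ℕ) (ξ : BlowUp d) :
    b.act (app (List.replicate n 0) ξ) = app (List.replicate n 0) (b.act ξ) := by
  induction n with
  | zero => rfl
  | succ n ih => rw [List.replicate_succ, app, act_cons_zero, ih, app]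

/-- A point of the blow-up is fixed as soon as its pointer is. -/
theorem act_eq_self {b : Directed d} {ξ : BlowUp d} (h : b.ptr (ξ.1 0).2 = (ξ.1 0).2) :
    b.act ξ = ξ := by
  refine BlowUp.ext fun n => ?_
  induction n generalizing ξ with
  | zero => rw [act_zero, h]
  | succ n ih =>
    -- After a leading `0` the tail has the same pointer; otherwise the pointer consists of the
    -- first two letters, the only ones that `b` can move.
    by_cases h0 : head ξ = 0
    · rw [state_zero_of_head_eq h0] at h
      simpa [act, actState, h0] using ih (ξ := tail ξ) h
    · rw [state_zero_of_head_ne h0] at h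
      have h2 : b.σ (head ξ) (head (tail ξ)) = head (tail ξ) := congrArg Prod.snd h
      simp [act, actState, h0, rootAct, h2]

/-- The pointer is part of the state at position `0`. With `act_eq_self` this makes being fixed a
locally constant condition, which is the source of regularity. -/
theorem ptr_of_act_eq_self {b : Directed d} {ξ : BlowUp d} (h : b.act ξ = ξ) :
    b.ptr (ξ.1 0).2 = (ξ.1 0).2 :=
  congrArg (fun ζ : BlowUp d => (ζ.1 0).2) h

theorem act_one (ξ : BlowUp d) : (one : Directed d).act ξ = ξ := act_eq_self rfl

theorem act_act (b c : Directed d) (ξ : BlowUp d) : b.act (c.act ξ) = (b.mul c).act ξ := by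
  refine BlowUp.ext fun n => ?_
  induction n generalizing ξ with
  | zero => simp [ptr, mul]
  | succ n ih =>
    rw [← cons_head_tail ξ]
    by_cases h : head ξ = 0
    · rw [h, act_cons_zero, act_cons_zero, act_cons_zero]
      exact ih _
    · rw [act_cons_of_ne c h, act_cons_of_ne b (c.ρ_ne h), act_cons_of_ne _ h, rootAct_rootAct]
      rfl

/-- The action on the blow-up is determined by the action on the pointers. -/
theorem act_congr {b c : Directed d} (h : ∀ p, b.ptr p = c.ptr p) (ξ : BlowUp d) :
    b.act ξ = c.act ξ := by
  refine BlowUp.ext fun n => ?_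
  induction n generalizing ξ with
  | zero => simp [h]
  | succ n ih =>
    rw [← cons_head_tail ξ]
    by_cases h0 : head ξ = 0
    · rw [h0, act_cons_zero, act_cons_zero]
      exact ih _
    · have hσ : b.σ (head ξ) = c.σ (head ξ) := Equiv.ext fun a =>
        congrArg Prod.snd (h (⟨head ξ, h0⟩, a))
      rw [act_cons_of_ne _ h0, act_cons_of_ne _ h0, hσ]
      rfl

theorem continuous_act (b : Directed d) : Continuous (b.act : BlowUp d → BlowUp d) := by
  refine Continuous.subtype_mk (continuous_pi fun n => ?_) _
  induction n with
  | zero =>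
    exact (continuous_of_discreteTopology (f := fun s : State d => (s.1, b.ptr s.2))).comp
      (continuous_state 0)
  | succ n ih =>
    refine continuous_iff_continuousAt.2 fun ξ => ?_
    have hc : ∀ᶠ ζ in 𝓝 ξ, head ζ = head ξ :=
      continuous_head.continuousAt.eventually (IsOpen.mem_nhds (isOpen_discrete {head ξ}) rfl)
    by_cases h : head ξ = 0
    · refine ContinuousAt.congr (f := fun ζ => b.actState n (tail ζ))
        (ih.comp continuous_tail).continuousAt ?_
      filter_upwards [hc] with ζ hζ
      simp [actState, hζ, h]
    · refine ContinuousAt.congr (f := fun ζ => (rootAct (b.σ (head ξ)) (tail ζ)).1 n)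
        ((continuous_state n).comp ((continuous_rootAct _).comp continuous_tail)).continuousAt ?_
      filter_upwards [hc] with ζ hζ
      simp [actState, hζ, h]

/-- The permutation of the blow-up given by `act`. -/
def perm (b : Directed d) : Equiv.Perm (BlowUp d) where
  toFun := b.act
  invFun := b.inv.act
  -- The composite fixes every pointer, hence every point.
  left_inv ξ := by rw [act_act]; exact act_eq_self (by simp [ptr, mul, inv])
  right_inv ξ := by rw [act_act]; exact act_eq_self (by simp [ptr, mul, inv])

end Directed

end BlowUp

/-! ### Lifting the mother group to the blow-up. -/

section Lifts

/-! ### Rays and the projection of the blow-up to the boundary -/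

variable {d : ℕ}

/-- Putting a letter in front of a ray. -/
def rayCons (c : Fin d) (z : TreeBoundary d) : TreeBoundary d
  | 0 => c
  | n + 1 => z n

/-- Putting a word in front of a ray. -/
def rayApp : List (Fin d) → TreeBoundary d → TreeBoundary d
  | [], z => z
  | c :: w, z => rayCons c (rayApp w z)

theorem rayCons_inj {c c' : Fin d} {z z' : TreeBoundary d} :
    rayCons c z = rayCons c' z' ↔ c = c' ∧ z = z' :=
  ⟨fun h => ⟨congrFun h 0, funext fun n => congrFun h (n + 1)⟩, fun h => by rw [h.1, h.2]⟩

theorem rayApp_inj {w w' : List (Fin d)} {z z' : TreeBoundary d} (hl : w.length = w'.length)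
    (h : rayApp w z = rayApp w' z') : w = w' ∧ z = z' := by
  induction w generalizing w' with
  | nil =>
    cases w' with
    | nil => exact ⟨rfl, h⟩
    | cons c w' => simp at hl
  | cons c w ih =>
    cases w' with
    | nil => simp at hl
    | cons c' w' =>
      obtain ⟨h1, h2⟩ := rayCons_inj.1 h
      obtain ⟨h3, h4⟩ := ih (by simpa using hl) h2
      exact ⟨by rw [h1, h3], h4⟩

theorem pre_rayCons (c : Fin d) (z : TreeBoundary d) (n : ℕ) :
    (rayCons c z).pre (n + 1) = c :: z.pre n := by
  simp only [TreeBoundary.pre, List.ofFn_succ]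
  rfl

theorem pre_smul (g : treeAut d) (z : TreeBoundary d) (n : ℕ) : (g • z).pre n = g.1 (z.pre n) :=
  TreeBoundary.pre_map g z n

theorem smul_rayCons {g : treeAut d} {s : Fin d → treeAut d} {ρ : Equiv.Perm (Fin d)}
    (h : HasWreathRecursion g s ρ) (x : Fin d) (z : TreeBoundary d) :
    g • rayCons x z = rayCons (ρ x) (s x • z) := by
  refine TreeBoundary.ext_pre fun n => ?_
  cases n with
  | zero => rfl
  | succ n => rw [pre_smul, pre_rayCons, pre_rayCons, pre_smul, h x]

theorem hasWreathRecursion_rooted (τ : Equiv.Perm (Fin d)) :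
    HasWreathRecursion (rooted τ) (fun _ => 1) τ := fun _ _ => rfl

theorem rooted_smul_rayCons (τ : Equiv.Perm (Fin d)) (x : Fin d) (z : TreeBoundary d) :
    rooted τ • rayCons x z = rayCons (τ x) z :=
  (smul_rayCons (hasWreathRecursion_rooted τ) x z).trans (by rw [one_smul])

theorem pre_rayApp (w : List (Fin d)) (z : TreeBoundary d) :
    (rayApp w z).pre w.length = w := by
  induction w with
  | nil => rfl
  | cons c w ih => rw [rayApp, List.length_cons, pre_rayCons, ih]

variable [NeZero d]

/-- The projection of the blow-up to the boundary. -/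
def proj (ξ : BlowUp d) : TreeBoundary d := fun n => letter (ξ.1 n)

theorem continuous_proj : Continuous (proj : BlowUp d → TreeBoundary d) :=
  continuous_pi fun n => (continuous_of_discreteTopology (f := letter)).comp (continuous_state n)

theorem proj_cons (c : Fin d) (ξ : BlowUp d) : proj (cons c ξ) = rayCons c (proj ξ) := by
  funext n
  cases n with
  | zero => exact head_cons c ξ
  | succ n => rfl

theorem proj_app (w : List (Fin d)) (ξ : BlowUp d) : proj (app w ξ) = rayApp w (proj ξ) := by
  induction w with
  | nil => rfl
  | cons c w ih => rw [app, proj_cons, ih, rayApp]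

theorem proj_rootAct (τ : Equiv.Perm (Fin d)) (ξ : BlowUp d) :
    proj (rootAct τ ξ) = rooted τ • proj ξ := by
  rw [← cons_head_tail ξ, rootAct_cons, proj_cons, proj_cons, rooted_smul_rayCons]

/-- The directed automorphism `g` has the wreath recursion given by `b`. -/
def Directed.IsRecursion (b : Directed d) (g : treeAut d) : Prop :=
  HasWreathRecursion g (fun x => if x = 0 then g else rooted (b.σ x)) b.ρ

/-- Both sides satisfy the same recursion. It reproduces itself below `0`, so the induction runs
over the coordinate that is compared. -/
theorem Directed.IsRecursion.proj_act {b : Directed d} {g : treeAut d} (h : b.IsRecursion g)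
    (ξ : BlowUp d) : proj (b.act ξ) = g • proj ξ := by
  funext n
  induction n generalizing ξ with
  | zero =>
    rw [← cons_head_tail ξ, proj_cons, smul_rayCons h]
    by_cases h0 : head ξ = 0
    · rw [h0, act_cons_zero, proj_cons, b.map_zero]
      rfl
    · rw [act_cons_of_ne _ h0, proj_cons]
      rfl
  | succ n ih =>
    rw [← cons_head_tail ξ, proj_cons, smul_rayCons h]
    by_cases h0 : head ξ = 0
    · rw [h0, act_cons_zero, proj_cons, if_pos rfl]
      exact ih _
    · rw [act_cons_of_ne _ h0, proj_cons, if_neg h0, proj_rootAct]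

theorem take_eq_of_proj_eq {ξ η : BlowUp d} (h : proj ξ = proj η) (n : ℕ) :
    take n ξ = take n η :=
  (rayApp_inj (by simp) (by
    rw [← proj_app, ← proj_app, app_take_drop, app_take_drop, h] :
      rayApp (take n ξ) (proj (drop n ξ)) = rayApp (take n η) (proj (drop n η)))).1

/-! ### Maps that are locally given by directed elements -/

/-- The map `F` is given by a directed element on all small enough cylinders around `η`, and shifts
the length of the prefixes by `L`. -/
def LocAt (F : BlowUp d → BlowUp d) (L : ℕ) (η : BlowUp d) : Prop :=
  ∀ᶠ k in atTop, ∃ (w : List (Fin d)) (b : Directed d), w.length = L + k ∧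
    ∀ ζ, F (app (take k η) ζ) = app w (b.act ζ)

/-- The map `f` has a trivial section at the word `w`. -/
def TrivAt (f : BlowUp d → BlowUp d) (w : List (Fin d)) : Prop :=
  ∃ w' : List (Fin d), w'.length = w.length ∧ ∀ ζ, f (app w ζ) = app w' ζ

/-- If a nonzero letter occurs before the last position, the first such letter and its successor
both lie inside the word, and nothing beyond is moved. The words left over on level `n` are the
`0ⁿ⁻¹ c` and possibly the empty word. -/
theorem Directed.trivAt_or (b : Directed d) (w : List (Fin d)) :
    TrivAt b.act w ∨ w = [] ∨ ∃ c, w = List.replicate (w.length - 1) 0 ++ [c] := by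
  induction w with
  | nil => exact Or.inr (Or.inl rfl)
  | cons c u ih =>
    by_cases hc : c = 0
    · subst hc
      rcases ih with ⟨w', hl, h⟩ | rfl | ⟨c, hc⟩
      · exact Or.inl ⟨0 :: w', by simp [hl], fun ζ => by simp [app, act_cons_zero, h]⟩
      · exact Or.inr (Or.inr ⟨0, by simp⟩)
      · refine Or.inr (Or.inr ⟨c, ?_⟩)
        have hl : 0 < u.length := by rw [hc]; simp
        obtain ⟨m, hm⟩ : ∃ m, u.length = m + 1 := ⟨u.length - 1, by omega⟩
        rw [List.length_cons, hm, Nat.add_sub_cancel, List.replicate_succ, List.cons_append]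
        rw [hm, Nat.add_sub_cancel] at hc
        rw [← hc]
    · cases u with
      | nil => exact Or.inr (Or.inr ⟨c, by simp⟩)
      | cons a u =>
        exact Or.inl ⟨b.ρ c :: b.σ c a :: u, by simp, fun ζ => by
          simp [app, act_cons_of_ne b hc]⟩

theorem getElem_take (n i : ℕ) (ξ : BlowUp d) (h : i < (take n ξ).length) :
    (take n ξ)[i] = letter (ξ.1 i) := by
  induction n generalizing i ξ with
  | zero => simp [take] at h
  | succ n ih =>
    cases i with
    | zero => rfl
    | succ i => exact ih i (tail ξ) (by simpa using h)

theorem Directed.locAt_act (b : Directed d) (η : BlowUp d) : LocAt b.act 0 η := by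
  by_cases h : ∀ k, letter (η.1 k) = 0
  · refine Eventually.of_forall fun k => ⟨List.replicate k 0, b, by simp, fun ζ => ?_⟩
    have : take k η = List.replicate k 0 := by
      refine List.ext_getElem (by simp) fun i h1 h2 => ?_
      rw [getElem_take, h, List.getElem_replicate]
    rw [this, act_app_zero]
  · push Not at h
    obtain ⟨j, hj⟩ := h
    -- Length `j + 2` puts the nonzero letter at position `j` strictly before the last one, which
    -- excludes the exceptional words.
    filter_upwards [eventually_ge_atTop (j + 2)] with k hk
    rcases b.trivAt_or (take k η) with ⟨w', hl, hw⟩ | h | ⟨c, hc⟩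
    · exact ⟨w', one, by simpa using hl, fun ζ => by rw [hw, act_one]⟩
    · have := congrArg List.length h
      simp at this
      omega
    · refine absurd ?_ hj
      rw [← getElem_take k j η (by simp; omega)]
      have h2 : (List.replicate ((take k η).length - 1) (0 : Fin d) ++ [c])[j]? = some 0 := by
        rw [List.getElem?_append_left (by simp; omega), List.getElem?_replicate,
          if_pos (by simp; omega)]
      rw [← hc] at h2
      exact (List.getElem?_eq_some_iff.1 h2).2

theorem LocAt.comp {f f' : BlowUp d → BlowUp d} {η : BlowUp d} (h' : LocAt f' 0 (f η))
    (h : LocAt f 0 η) : LocAt (f' ∘ f) 0 η := by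
  filter_upwards [h, h'] with k ⟨w, b, hw, hb⟩ ⟨w', b', hw', hb'⟩
  rw [zero_add] at hw hw'
  have : take k (f η) = w := by
    rw [← app_take_drop k η, hb, take_app hw]
  rw [this] at hb'
  exact ⟨w', b'.mul b, by rw [hw', zero_add], fun ζ => by
    rw [Function.comp_apply, hb, hb', Directed.act_act]⟩

theorem LocAt.comp_app {f : BlowUp d → BlowUp d} {w : List (Fin d)} {η : BlowUp d}
    (h : LocAt f 0 (app w η)) : LocAt (fun ζ => f (app w ζ)) w.length η := by
  filter_upwards [(tendsto_add_atTop_nat w.length).eventually h] with k ⟨w', b, hw', hb⟩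
  rw [add_comm k, take_app_add] at hb
  exact ⟨w', b, by omega, fun ζ => by rw [← hb, app_append]⟩

theorem LocAt.app_comp {f : BlowUp d → BlowUp d} {η : BlowUp d} (h : LocAt f 0 η)
    (w : List (Fin d)) : LocAt (fun ζ => app w (f ζ)) w.length η := by
  filter_upwards [h] with k ⟨w', b, hw', hb⟩
  exact ⟨w ++ w', b, by simp [hw'], fun ζ => by rw [hb, app_append]⟩

/-- The action on the pointer `(x, a)` is visible on ordinary rays, namely on those that start with
`x a`. -/
theorem Directed.ptr_eq_of_proj {b c : Directed d}
    (h : ∀ ζ : BlowUp d, proj (b.act ζ) = proj (c.act ζ)) (ζ : BlowUp d) (p : Pointer d) :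
    b.ptr p = c.ptr p := by
  have h1 := h (cons p.1 (cons p.2 ζ))
  rw [act_cons_of_ne _ p.1.2, act_cons_of_ne _ p.1.2, proj_cons, proj_cons, rayCons_inj,
    rootAct_cons, rootAct_cons, proj_cons, proj_cons, rayCons_inj] at h1
  exact Prod.ext (Subtype.ext h1.1) h1.2.1

/-- A map that is locally given by directed elements is determined by its projection. -/
theorem LocAt.eq_of_proj {F F' : BlowUp d → BlowUp d} {L : ℕ} {η : BlowUp d} (h : LocAt F L η)
    (h' : LocAt F' L η) (hp : ∀ ζ, proj (F ζ) = proj (F' ζ)) : F η = F' η := by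
  obtain ⟨k, ⟨w, b, hw, hb⟩, w', b', hw', hb'⟩ := (h.and h').exists
  -- The local formulas hold for all continuations `ζ`, not only for that of `η`. So rays near `η`
  -- reveal the directed element even if `η` lies over an eventually zero ray.
  have h1 : ∀ ζ : BlowUp d, w = w' ∧ proj (b.act ζ) = proj (b'.act ζ) := fun ζ =>
    rayApp_inj (hw.trans hw'.symm) (by rw [← proj_app, ← proj_app, ← hb, ← hb', hp])
  rw [← app_take_drop k η, hb, hb', (h1 η).1,
    Directed.act_congr (Directed.ptr_eq_of_proj (fun ζ => (h1 ζ).2) η)]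

theorem LocAt.continuousAt {F : BlowUp d → BlowUp d} {L : ℕ} {η : BlowUp d} (h : LocAt F L η) :
    ContinuousAt F η := by
  obtain ⟨k, w, b, -, hb⟩ := h.exists
  refine ContinuousAt.congr (f := fun ζ => app w (b.act (drop k ζ)))
    ((continuous_app w).comp (b.continuous_act.comp (continuous_drop k))).continuousAt ?_
  filter_upwards [(isOpen_take_eq k (take k η)).mem_nhds rfl] with ζ hζ
  rw [← hb, ← show take k ζ = take k η from hζ, app_take_drop]

/-- A map that is locally given by directed elements fixes a neighbourhood of each fixed point. -/
theorem LocAt.eventually_eq_self {F : BlowUp d → BlowUp d} {η : BlowUp d} (h : LocAt F 0 η)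
    (hη : F η = η) : ∀ᶠ ζ in 𝓝 η, F ζ = ζ := by
  obtain ⟨k, w, b, hw, hb⟩ := h.exists
  rw [zero_add] at hw
  have h1 := hb (drop k η)
  rw [app_take_drop, hη] at h1
  have h2 : take k η = w := by rw [h1, take_app hw]
  have h3 : b.act (drop k η) = drop k η := app_injective w (by rw [← h1, ← h2, app_take_drop])
  have h4 := Directed.ptr_of_act_eq_self h3
  -- Points with the same first `k` letters and the same state at `k` have the same pointer after
  -- the prefix, and `b` fixes that pointer.
  filter_upwards [(isOpen_take_eq k (take k η)).mem_nhds rfl,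
    (isOpen_state_eq k (η.1 k)).mem_nhds rfl] with ζ hζ hζ'
  have h5 : (drop k ζ).1 0 = (drop k η).1 0 := by simpa using hζ'
  rw [← app_take_drop k ζ, show take k ζ = take k η from hζ, hb, ← h2,
    Directed.act_eq_self (by rw [h5, h4])]

/-! ### Lifts to the blow-up -/

/-- The permutation `f` of the blow-up is a lift of the tree automorphism `g` which is locally
given by directed elements and has a bounded number of nontrivial sections on each level. -/
structure IsLift (g : treeAut d) (f : Equiv.Perm (BlowUp d)) : Prop where
  proj_apply : ∀ ξ, proj (f ξ) = g • proj ξ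
  locAt : ∀ ξ, LocAt f 0 ξ
  bounded : ∃ K : ℕ, ∀ n, {w : List (Fin d) | w.length = n ∧ ¬ TrivAt f w}.encard ≤ K

/-- Uniqueness makes the chosen lifts multiplicative, hence an action. -/
theorem IsLift.unique {g : treeAut d} {f f' : Equiv.Perm (BlowUp d)} (h : IsLift g f)
    (h' : IsLift g f') : f = f' :=
  Equiv.ext fun ξ => (h.locAt ξ).eq_of_proj (h'.locAt ξ) fun ζ => by
    rw [h.proj_apply, h'.proj_apply]

/-- If a tree automorphism acts like the directed element `b` below the word `w`, then so does
its lift. -/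
theorem IsLift.app_eq {g : treeAut d} {f : Equiv.Perm (BlowUp d)} (h : IsLift g f)
    {w w' : List (Fin d)} (hl : w.length = w'.length) {b : Directed d}
    (hb : ∀ ζ : BlowUp d, g • rayApp w (proj ζ) = rayApp w' (proj (b.act ζ))) (ξ : BlowUp d) :
    f (app w ξ) = app w' (b.act ξ) := by
  refine (h.locAt (app w ξ)).comp_app.eq_of_proj (hl ▸ (b.locAt_act ξ).app_comp w') fun ζ => ?_
  rw [h.proj_apply, proj_app, hb, proj_app]

theorem isLift_one : IsLift (1 : treeAut d) 1 where
  proj_apply ξ := by rw [one_smul]; rfl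
  locAt ξ := Eventually.of_forall fun k => ⟨take k ξ, Directed.one, by simp, fun ζ => by
    rw [Directed.act_one]; rfl⟩
  bounded := ⟨0, fun n => by
    rw [Nat.cast_zero, nonpos_iff_eq_zero, Set.encard_eq_zero, Set.eq_empty_iff_forall_notMem]
    exact fun w hw => hw.2 ⟨w, rfl, fun _ => rfl⟩⟩

theorem IsLift.mul {g g' : treeAut d} {f f' : Equiv.Perm (BlowUp d)} (h : IsLift g f)
    (h' : IsLift g' f') : IsLift (g * g') (f * f') where
  proj_apply ξ := by rw [Equiv.Perm.mul_apply, h.proj_apply, h'.proj_apply, mul_smul]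
  locAt ξ := (h.locAt (f' ξ)).comp (h'.locAt ξ)
  bounded := by
    obtain ⟨K, hK⟩ := h.bounded
    obtain ⟨K', hK'⟩ := h'.bounded
    refine ⟨K + K', fun n => ?_⟩
    -- A nontrivial section of the product at `w` needs one of `f'` at `w` or one of `f` at the
    -- image word `g' w`.
    have hsub : {w : List (Fin d) | w.length = n ∧ ¬ TrivAt (f * f') w} ⊆
        g'.1 ⁻¹' {w | w.length = n ∧ ¬ TrivAt f w} ∪ {w | w.length = n ∧ ¬ TrivAt f' w} := by
      rintro w ⟨hw, hn⟩
      by_cases ht : TrivAt f' w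
      · refine Or.inl ⟨(g'.2.1 w).trans hw, ?_⟩
        obtain ⟨w', hl, hw'⟩ := ht
        rintro ⟨w'', hl', hw''⟩
        have hg : g'.1 w = w' := by
          -- On an empty blow-up every section would be trivial, against `hn`.
          obtain ⟨ζ⟩ : Nonempty (BlowUp d) := by
            by_contra he
            exact hn ⟨w, rfl, fun ζ => absurd ⟨ζ⟩ he⟩
          have h1 := h'.proj_apply (app w ζ)
          rw [hw', proj_app, proj_app] at h1
          rw [← pre_rayApp w (proj ζ), ← pre_smul, ← h1, ← hl, pre_rayApp]
        refine hn ⟨w'', by rw [hl', g'.2.1], fun ζ => ?_⟩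
        rw [Equiv.Perm.mul_apply, hw', ← hg, hw'']
      · exact Or.inr ⟨hw, ht⟩
    calc _ ≤ _ := (Set.encard_le_encard hsub).trans (Set.encard_union_le _ _)
      _ ≤ _ := by
        push_cast
        refine add_le_add ?_ (hK' n)
        rw [Set.encard_preimage_of_bijective g'.1.bijective]
        exact hK n

/-- Only the projection of `g` is prescribed, so that the inverses of generators are covered as
well; likewise in `Directed.isLift_perm`. -/
theorem isLift_rootPerm {g : treeAut d} {τ : Equiv.Perm (Fin d)}
    (hg : ∀ ξ : BlowUp d, proj (rootAct τ ξ) = g • proj ξ) : IsLift g (rootPerm τ) where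
  proj_apply := hg
  locAt ξ := by
    filter_upwards [eventually_ge_atTop 1] with k hk
    obtain ⟨k, rfl⟩ : ∃ m, k = m + 1 := ⟨k - 1, by omega⟩
    exact ⟨τ (head ξ) :: take k (tail ξ), Directed.one, by simp, fun ζ => by
      rw [Directed.act_one]; exact rootAct_cons _ _ _⟩
  bounded := ⟨1, fun n => by
    refine (Set.encard_le_encard (t := {[]}) ?_).trans (by simp)
    rintro (_ | ⟨c, w⟩) ⟨-, hw⟩
    · rfl
    · exact absurd ⟨τ c :: w, by simp, fun ζ => rootAct_cons _ _ _⟩ hw⟩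

theorem Directed.isLift_perm {g : treeAut d} {b : Directed d}
    (hg : ∀ ξ : BlowUp d, proj (b.act ξ) = g • proj ξ) : IsLift g b.perm where
  proj_apply := hg
  locAt := b.locAt_act
  -- One exceptional word `0ⁿ⁻¹ c` for each letter `c`, and the empty word.
  bounded := ⟨d + 1, fun n => by
    have hsub : {w : List (Fin d) | w.length = n ∧ ¬ TrivAt b.perm w} ⊆
        (fun c : Fin d => List.replicate (n - 1) 0 ++ [c]) '' Set.univ ∪ {[]} := by
      rintro w ⟨rfl, hw⟩
      rcases b.trivAt_or w with h | h | ⟨c, hc⟩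
      · exact absurd h hw
      · exact Or.inr h
      · exact Or.inl ⟨c, trivial, hc.symm⟩
    refine (Set.encard_le_encard hsub).trans ((Set.encard_union_le _ _).trans ?_)
    push_cast
    refine add_le_add ((Set.encard_image_le _ _).trans ?_) (by simp)
    simp⟩

/-- Every element of the mother group has a lift. -/
theorem exists_isLift {g : treeAut d} (hg : g ∈ motherGroup d) : ∃ f, IsLift g f := by
  have hA : ∀ g ∈ motherA d ∪ motherB d, (∃ τ : Equiv.Perm (Fin d), ∀ ξ : BlowUp d,
      proj (rootAct τ ξ) = g • proj ξ) ∨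
      ∃ b : Directed d, ∀ ξ : BlowUp d, proj (b.act ξ) = g • proj ξ := by
    rintro g (⟨τ, -, h⟩ | ⟨σ, ρ, -, -, h0, h⟩)
    · refine Or.inl ⟨τ, fun ξ => ?_⟩
      rw [← cons_head_tail ξ, rootAct_cons, proj_cons, proj_cons, smul_rayCons h, one_smul]
    · exact Or.inr ⟨⟨σ, ρ, h0⟩, Directed.IsRecursion.proj_act h⟩
  induction hg using Subgroup.closure_induction'' with
  | one => exact ⟨1, isLift_one⟩
  | mul x y _ _ hx hy =>
    obtain ⟨f, hf⟩ := hx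
    obtain ⟨f', hf'⟩ := hy
    exact ⟨f * f', hf.mul hf'⟩
  | mem x hx =>
    rcases hA x hx with ⟨τ, h⟩ | ⟨b, h⟩
    · exact ⟨_, isLift_rootPerm h⟩
    · exact ⟨_, Directed.isLift_perm h⟩
  | inv_mem x hx =>
    rcases hA x hx with ⟨τ, h⟩ | ⟨b, h⟩
    · refine ⟨_, isLift_rootPerm (τ := τ⁻¹) fun ξ => ?_⟩
      rw [eq_inv_smul_iff, ← h, rootAct_rootAct, mul_inv_cancel, rootAct_one]
    · refine ⟨_, Directed.isLift_perm (b := b.inv) fun ξ => ?_⟩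
      rw [eq_inv_smul_iff, ← h]
      exact congrArg proj (b.perm.apply_symm_apply ξ)

end Lifts

/-! ### The Schreier system as the set of stabilisers of the blow-up. -/

section Stability

/-! ### The Chabauty topology -/

instance (G : Type*) [Group G] : T2Space (Subgroup G) := by
  classical
  refine T2Space.of_injective_continuous
    (f := fun (H : Subgroup G) (g : G) => @decide (g ∈ H) (Classical.propDecidable _)) ?_
    continuous_induced_dom
  intro H K h
  ext g
  simpa using congrFun h g

/-- A map to the space of subgroups is continuous at a point if membership of each group element is
locally constant there. -/
theorem continuousAt_subgroup {G Y : Type*} [Group G] [TopologicalSpace Y] {F : Y → Subgroup G}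
    {y : Y} (h : ∀ g, ∀ᶠ z in 𝓝 y, (g ∈ F z ↔ g ∈ F y)) : ContinuousAt F y := by
  have hi : Topology.IsInducing fun (H : Subgroup G) (g : G) =>
    @decide (g ∈ H) (Classical.propDecidable _) := ⟨rfl⟩
  refine hi.continuousAt_iff.2 (continuousAt_pi.2 fun g => ?_)
  refine ContinuousAt.congr (f := fun _ => @decide (g ∈ F y) (Classical.propDecidable _))
    continuousAt_const ?_
  filter_upwards [h g] with z hz
  simp [hz]

/-- The stabiliser map is continuous at a point that is fixed together with a neighbourhood by all
elements of its stabiliser. -/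
theorem continuousAt_stabilizer {G Y : Type*} [Group G] [TopologicalSpace Y] [T2Space Y]
    [MulAction G Y] [ContinuousConstSMul G Y] {y : Y} (h : IsTopologicallyRegularPoint G y) :
    ContinuousAt (fun z : Y => MulAction.stabilizer G z) y := by
  refine continuousAt_subgroup fun g => ?_
  by_cases hg : g • y = y
  · filter_upwards [h g hg] with z hz
    simp [MulAction.mem_stabilizer_iff, hz, hg]
  · have ho : IsOpen {z : Y | g • z ≠ z} :=
      (isClosed_eq (continuous_const_smul g) continuous_id).isOpen_compl
    filter_upwards [ho.mem_nhds hg] with z hz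
    simp only [MulAction.mem_stabilizer_iff]
    exact ⟨fun h => absurd h hz, fun h => absurd h hg⟩

/-! ### The action on the blow-up -/

variable {d : ℕ} [NeZero d]

/-- The lift of an element of the mother group. -/
def lift (g : motherGroup d) : Equiv.Perm (BlowUp d) := (exists_isLift g.2).choose

theorem isLift_lift (g : motherGroup d) : IsLift (g : treeAut d) (lift g) :=
  (exists_isLift g.2).choose_spec

instance : MulAction (motherGroup d) (BlowUp d) where
  smul g ξ := lift g ξ
  one_smul ξ := by
    show lift 1 ξ = ξ
    rw [(isLift_lift (1 : motherGroup d)).unique isLift_one]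
    rfl
  mul_smul g h ξ := by
    show lift (g * h) ξ = lift g (lift h ξ)
    rw [(isLift_lift (g * h)).unique ((isLift_lift g).mul (isLift_lift h))]
    rfl

theorem proj_smul (g : motherGroup d) (ξ : BlowUp d) : proj (g • ξ) = g • proj ξ :=
  (isLift_lift g).proj_apply ξ

instance : ContinuousConstSMul (motherGroup d) (BlowUp d) where
  continuous_const_smul g :=
    continuous_iff_continuousAt.2 fun ξ => ((isLift_lift g).locAt ξ).continuousAt

theorem isTopologicallyRegular_blowUp : IsTopologicallyRegular (motherGroup d) (BlowUp d) :=
  fun ξ g hg => ((isLift_lift g).locAt ξ).eventually_eq_self hg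

theorem continuous_stabilizer :
    Continuous fun ξ : BlowUp d => MulAction.stabilizer (motherGroup d) ξ :=
  continuous_iff_continuousAt.2 fun ξ => continuousAt_stabilizer (isTopologicallyRegular_blowUp ξ)

/-! ### Recurrent rays -/

/-- A ray that is not eventually `0`. -/
def Recurrent (z : TreeBoundary d) : Prop := ∀ n, ∃ m ≥ n, z m ≠ 0

theorem Recurrent.rayCons {z : TreeBoundary d} (h : Recurrent z) (c : Fin d) :
    Recurrent (rayCons c z) := fun n => by
  obtain ⟨m, hm, hz⟩ := h n
  exact ⟨m + 1, by omega, hz⟩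

theorem Recurrent.rayApp {z : TreeBoundary d} (h : Recurrent z) (w : List (Fin d)) :
    Recurrent (rayApp w z) := by
  induction w with
  | nil => exact h
  | cons c w ih => exact ih.rayCons c

theorem state_of_letter_ne {ξ : BlowUp d} {n : ℕ} (h : proj ξ n ≠ 0) :
    ξ.1 n = (false, ⟨proj ξ n, h⟩, proj ξ (n + 1)) := by
  rw [ξ.2 n]
  exact prev_of_ne h _

/-- A point of the blow-up is determined by its projection if that is not eventually `0`. -/
theorem Recurrent.eq_of_proj_eq {ξ η : BlowUp d} (h : Recurrent (proj ξ))
    (he : proj ξ = proj η) : ξ = η := by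
  refine BlowUp.ext fun n => ?_
  obtain ⟨m, hm, hz⟩ := h n
  refine state_eq_of_take (take_eq_of_proj_eq he m) ?_ n hm
  rw [state_of_letter_ne hz, state_of_letter_ne (he ▸ hz)]
  simp only [he]

theorem exists_recurrent_state (s : State d) :
    ∃ η : BlowUp d, Recurrent (proj η) ∧ η.1 0 = s := by
  obtain ⟨k, x, a⟩ := s
  -- The ray `x^∞`; putting `0 x a` or `x a` in front of it produces the required state.
  let ζ : BlowUp d := ⟨fun _ => (false, x, x), fun n => (prev_of_ne x.2 (false, x, x.1)).symm⟩
  have hζ : Recurrent (proj ζ) := fun n => ⟨n, le_rfl, x.2⟩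
  cases k with
  | true =>
    refine ⟨app [0, x, a] ζ, by rw [proj_app]; exact hζ.rayApp _, ?_⟩
    simp [app, prev_of_ne x.2]
  | false =>
    refine ⟨app [x.1, a] ζ, by rw [proj_app]; exact hζ.rayApp _, ?_⟩
    simp [app, prev_of_ne x.2]

/-- Keep the first `n` letters of `ξ` and continue with a recurrent point in the state `ξ.1 n`: all
states up to position `n` then agree with those of `ξ`. -/
theorem dense_recurrent : Dense {ξ : BlowUp d | Recurrent (proj ξ)} := by
  intro ξ
  choose η hη hs using exists_recurrent_state (d := d)
  refine mem_closure_of_tendsto (f := fun n => app (take n ξ) (η (ξ.1 n))) (b := atTop) ?_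
    (Eventually.of_forall fun n => ?_)
  · refine tendsto_subtype_rng.2 (tendsto_pi_nhds.2 fun i => ?_)
    refine tendsto_const_nhds.congr' ?_
    filter_upwards [eventually_ge_atTop i] with n hn
    refine (state_eq_of_take (take_app (length_take n ξ) _) ?_ i hn).symm
    have h := drop_val n 0 (app (take n ξ) (η (ξ.1 n)))
    rw [drop_app (length_take n ξ), hs] at h
    exact h.symm
  · show Recurrent (proj _)
    rw [proj_app]
    exact (hη _).rayApp _

/-- The range is compact, hence closed, and it meets every cylinder. -/
theorem surjective_proj [Nonempty (BlowUp d)] :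
    Function.Surjective (proj : BlowUp d → TreeBoundary d) := by
  intro z
  obtain ⟨ξ⟩ := ‹Nonempty (BlowUp d)›
  have hc : IsClosed (range (proj : BlowUp d → TreeBoundary d)) :=
    (isCompact_range continuous_proj).isClosed
  refine hc.closure_subset (mem_closure_of_tendsto (f := fun n => proj (app (z.pre n) ξ))
    (b := atTop) ?_ (Eventually.of_forall fun n => mem_range_self _))
  refine tendsto_pi_nhds.2 fun i => ?_
  refine tendsto_const_nhds.congr' ?_
  filter_upwards [eventually_gt_atTop i] with n hn
  have h := pre_rayApp (z.pre n) (proj ξ)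
  rw [← proj_app, show (z.pre n).length = n by simp [TreeBoundary.pre]] at h
  exact (congrFun (List.ofFn_injective h) ⟨i, hn⟩).symm

/-! ### The stability system -/

theorem stabilizer_eq_of_recurrent {ξ : BlowUp d} (h : Recurrent (proj ξ)) :
    MulAction.stabilizer (motherGroup d) ξ = MulAction.stabilizer (motherGroup d) (proj ξ) := by
  ext g
  rw [MulAction.mem_stabilizer_iff, MulAction.mem_stabilizer_iff, ← proj_smul]
  exact ⟨fun hg => by rw [hg], fun hg => (h.eq_of_proj_eq hg.symm).symm⟩

/-- The fibre over `proj ξ` is a single point and `proj` is closed, so a neighbourhood of `ξ` fixed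
by `g` contains the preimage of a neighbourhood of `proj ξ`. -/
theorem isTopologicallyRegularPoint_of_recurrent {ξ : BlowUp d} (h : Recurrent (proj ξ)) :
    IsTopologicallyRegularPoint (motherGroup d) (proj ξ) := by
  intro g hg
  have hξ : g • ξ = ξ := (h.eq_of_proj_eq ((proj_smul g ξ).trans hg).symm).symm
  have hU := isTopologicallyRegular_blowUp ξ g hξ
  obtain ⟨U, hU, hUo, hξU⟩ := eventually_nhds_iff.1 hU
  have hcl : IsClosed (proj '' Uᶜ) :=
    (hUo.isClosed_compl.isCompact.image continuous_proj).isClosed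
  have hmem : proj ξ ∈ (proj '' Uᶜ)ᶜ := by
    rintro ⟨η, hη, he⟩
    exact hη ((h.eq_of_proj_eq he.symm) ▸ hξU)
  have : Nonempty (BlowUp d) := ⟨ξ⟩
  filter_upwards [hcl.isOpen_compl.mem_nhds hmem] with z hz
  obtain ⟨ζ, rfl⟩ := surjective_proj z
  rw [← proj_smul, hU ζ (by_contra fun h => hz ⟨ζ, h, rfl⟩)]

/-- At a point of continuity, stabilisers along nearby recurrent points converge both to the
stabiliser of the ray and to that of any preimage; the Chabauty topology is Hausdorff. Conversely,
recurrent rays are points of continuity and their preimages are dense. -/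
theorem stabilitySet_eq_range [Nonempty (BlowUp d)] :
    stabilitySet (motherGroup d) (TreeBoundary d) =
      range fun ξ : BlowUp d => MulAction.stabilizer (motherGroup d) ξ := by
  have hcl : IsClosed (range fun ξ : BlowUp d => MulAction.stabilizer (motherGroup d) ξ) :=
    (isCompact_range continuous_stabilizer).isClosed
  refine (closure_minimal ?_ hcl).antisymm ?_
  · rintro _ ⟨z, hz, rfl⟩
    obtain ⟨ξ, rfl⟩ := surjective_proj z
    refine ⟨ξ, ?_⟩
    have hne : (𝓝[{ξ : BlowUp d | Recurrent (proj ξ)}] ξ).NeBot :=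
      mem_closure_iff_nhdsWithin_neBot.1 (dense_recurrent ξ)
    have h1 : Tendsto (fun ζ : BlowUp d => MulAction.stabilizer (motherGroup d) ζ)
        (𝓝[{ξ : BlowUp d | Recurrent (proj ξ)}] ξ) (𝓝 (MulAction.stabilizer (motherGroup d) ξ)) :=
      (continuous_stabilizer.tendsto ξ).mono_left nhdsWithin_le_nhds
    have h2 : Tendsto (fun ζ : BlowUp d => MulAction.stabilizer (motherGroup d) (proj ζ))
        (𝓝[{ξ : BlowUp d | Recurrent (proj ξ)}] ξ)
        (𝓝 (MulAction.stabilizer (motherGroup d) (proj ξ))) :=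
      (ContinuousAt.comp (f := proj) hz continuous_proj.continuousAt).tendsto.mono_left
        nhdsWithin_le_nhds
    refine tendsto_nhds_unique h1 (h2.congr' ?_)
    filter_upwards [self_mem_nhdsWithin] with ζ hζ
    exact (stabilizer_eq_of_recurrent hζ).symm
  · rintro _ ⟨ξ, rfl⟩
    have h := image_closure_subset_closure_image continuous_stabilizer
      (mem_image_of_mem (fun ξ : BlowUp d => MulAction.stabilizer (motherGroup d) ξ)
        (dense_recurrent ξ))
    refine closure_mono ?_ h
    rintro _ ⟨ζ, hζ, rfl⟩
    exact ⟨proj ζ, continuousAt_stabilizer (isTopologicallyRegularPoint_of_recurrent hζ),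
      (stabilizer_eq_of_recurrent hζ).symm⟩

end Stability

/-! ### Branching, and injectivity of the stabiliser map. -/

section Separation

open scoped commutatorElement

/-! ### Alternating permutations -/

theorem exists_notMem_triple {d : ℕ} (hd : 4 ≤ d) (x y u : Fin d) :
    ∃ w, w ≠ x ∧ w ≠ y ∧ w ≠ u := by
  by_contra! h
  have hs : (Finset.univ : Finset (Fin d)) ⊆ {x, y, u} := fun w _ => by
    simp only [Finset.mem_insert, Finset.mem_singleton]
    by_contra! hw
    exact hw.2.2 (h w hw.1 hw.2.1)
  have := (Finset.card_le_card hs).trans Finset.card_le_three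
  simp at this
  omega

theorem exists_alternating_apply_eq {d : ℕ} (hd : 4 ≤ d) {x y u : Fin d} (hxy : x ≠ y)
    (hx : u ≠ x) (hy : u ≠ y) : ∃ τ ∈ alternatingGroup (Fin d), τ x = y ∧ τ u = u := by
  obtain ⟨w, hwx, hwy, hwu⟩ := exists_notMem_triple hd x y u
  -- A 3-cycle on `x`, `y`, `w`; the fourth letter `w` makes it even without touching `u`.
  refine ⟨Equiv.swap x y * Equiv.swap y w, ?_, ?_, ?_⟩
  · rw [Equiv.Perm.mem_alternatingGroup, Equiv.Perm.sign_mul, Equiv.Perm.sign_swap hxy,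
      Equiv.Perm.sign_swap hwy.symm]
    rfl
  · rw [Equiv.Perm.mul_apply, Equiv.swap_apply_of_ne_of_ne hxy hwx.symm, Equiv.swap_apply_left]
  · rw [Equiv.Perm.mul_apply, Equiv.swap_apply_of_ne_of_ne hy hwu.symm,
      Equiv.swap_apply_of_ne_of_ne hx hy]

theorem exists_alternating_transitive {d : ℕ} (hd : 4 ≤ d) (x y : Fin d) :
    ∃ τ ∈ alternatingGroup (Fin d), τ x = y := by
  by_cases h : x = y
  · exact ⟨1, one_mem _, h⟩
  · obtain ⟨u, hx, hy, -⟩ := exists_notMem_triple hd x y y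
    obtain ⟨τ, hτ, h1, -⟩ := exists_alternating_apply_eq hd h hx hy
    exact ⟨τ, hτ, h1⟩

/-! ### Tree automorphisms with prescribed sections -/

variable {d : ℕ}

theorem treeAut_ext {g h : treeAut d} (H : ∀ w, g.1 w = h.1 w) : g = h :=
  Subtype.ext (Equiv.ext H)

/-- Letting `s x` act on the words that start with `x`. -/
def sectionsFun (s : Fin d → treeAut d) : List (Fin d) → List (Fin d)
  | [] => []
  | x :: w => x :: (s x).1 w

theorem sectionsFun_inv (s : Fin d → treeAut d) (w : List (Fin d)) :
    sectionsFun s⁻¹ (sectionsFun s w) = w := by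
  cases w with
  | nil => rfl
  | cons x w => simp [sectionsFun]

/-- The automorphism that fixes the first level and has the section `s x` at `x`. -/
def sections : (Fin d → treeAut d) →* treeAut d where
  toFun s := ⟨{ toFun := sectionsFun s
                invFun := sectionsFun s⁻¹
                left_inv := sectionsFun_inv s
                right_inv := fun w => by simpa using sectionsFun_inv s⁻¹ w },
    by rintro (_ | ⟨x, w⟩) <;> simp [sectionsFun, (s _).2.1],
    by
      rintro (_ | ⟨x, w⟩) (_ | ⟨y, v⟩) <;> simp [sectionsFun, List.cons_prefix_cons]
      rintro rfl
      exact (s x).2.2 w v⟩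
  map_one' := treeAut_ext <| by rintro (_ | ⟨x, w⟩) <;> rfl
  map_mul' s t := treeAut_ext <| by rintro (_ | ⟨x, w⟩) <;> rfl

theorem hasWreathRecursion_sections (s : Fin d → treeAut d) :
    HasWreathRecursion (sections s) s 1 := fun _ _ => rfl

theorem rooted_mul (τ τ' : Equiv.Perm (Fin d)) : rooted (τ * τ') = rooted τ * rooted τ' :=
  treeAut_ext <| by rintro (_ | ⟨x, w⟩) <;> rfl

/-- The embedding of the permutations of the alphabet. -/
def rootedHom : Equiv.Perm (Fin d) →* treeAut d := MonoidHom.mk' rooted rooted_mul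

theorem rootedHom_apply (τ : Equiv.Perm (Fin d)) : rootedHom τ = rooted τ := rfl

theorem rootedHom_conj_sections (τ : Equiv.Perm (Fin d)) (s : Fin d → treeAut d) :
    rootedHom τ * sections s * (rootedHom τ)⁻¹ = sections fun x => s (τ⁻¹ x) := by
  rw [mul_inv_eq_iff_eq_mul]
  refine treeAut_ext ?_
  rintro (_ | ⟨x, w⟩)
  · rfl
  · show τ x :: (s x).1 w = τ x :: (s (τ⁻¹ (τ x))).1 w
    simp

/-- The embedding of the tree automorphisms as those acting only below the letter `c`. -/
def below (c : Fin d) : treeAut d →* treeAut d :=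
  sections.comp (MonoidHom.mulSingle (fun _ : Fin d => treeAut d) c)

theorem below_apply (c : Fin d) (g : treeAut d) : below c g = sections (Pi.mulSingle c g) := rfl

theorem rootedHom_conj_below (τ : Equiv.Perm (Fin d)) (c : Fin d) (g : treeAut d) :
    rootedHom τ * below c g * (rootedHom τ)⁻¹ = below (τ c) g := by
  rw [below_apply, rootedHom_conj_sections, below_apply]
  congr 1
  funext x
  by_cases h : x = τ c
  · subst h
    simp
  · rw [Pi.mulSingle_eq_of_ne h, Pi.mulSingle_eq_of_ne]
    rwa [Ne, Equiv.Perm.inv_eq_iff_eq]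

theorem below_smul_rayCons (c : Fin d) (g : treeAut d) (z : TreeBoundary d) :
    below c g • rayCons c z = rayCons c (g • z) := by
  rw [below_apply, smul_rayCons (hasWreathRecursion_sections _), Pi.mulSingle_eq_same]
  rfl

theorem below_smul_rayCons_of_ne {c c' : Fin d} (h : c' ≠ c) (g : treeAut d)
    (z : TreeBoundary d) : below c g • rayCons c' z = rayCons c' z := by
  rw [below_apply, smul_rayCons (hasWreathRecursion_sections _), Pi.mulSingle_eq_of_ne h, one_smul]
  rfl

variable [NeZero d]

/-- The map `g = (g, σ 1, …, σ (d-1))` on words. -/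
def directedFun (σ : Fin d → Equiv.Perm (Fin d)) : List (Fin d) → List (Fin d)
  | [] => []
  | x :: w => x :: if x = 0 then directedFun σ w else permFirst (σ x) w

theorem directedFun_inv (σ : Fin d → Equiv.Perm (Fin d)) (w : List (Fin d)) :
    directedFun σ⁻¹ (directedFun σ w) = w := by
  induction w with
  | nil => rfl
  | cons x w ih =>
    by_cases h : x = 0
    · simp [directedFun, h, ih]
    · cases w <;> simp [directedFun, h, permFirst]

theorem length_directedFun (σ : Fin d → Equiv.Perm (Fin d)) (w : List (Fin d)) :
    (directedFun σ w).length = w.length := by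
  induction w with
  | nil => rfl
  | cons x w ih =>
    by_cases h : x = 0
    · simp [directedFun, h, ih]
    · cases w <;> simp [directedFun, h, permFirst]

theorem directedFun_prefix (σ : Fin d → Equiv.Perm (Fin d)) (u v : List (Fin d)) :
    u <+: v ↔ directedFun σ u <+: directedFun σ v := by
  induction u generalizing v with
  | nil => simp [directedFun]
  | cons x u ih =>
    cases v with
    | nil => simp [directedFun]
    | cons y v =>
      rw [directedFun, directedFun, List.cons_prefix_cons, List.cons_prefix_cons]
      refine and_congr_right ?_
      rintro rfl
      by_cases h : x = 0
      · simpa [h] using ih v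
      · simp only [h, if_false]
        exact (rooted (σ x)).2.2 u v

/-- The directed automorphism `g = (g, σ 1, …, σ (d-1))`. -/
def directed (σ : Fin d → Equiv.Perm (Fin d)) : treeAut d :=
  ⟨{ toFun := directedFun σ
     invFun := directedFun σ⁻¹
     left_inv := directedFun_inv σ
     right_inv := fun w => by simpa using directedFun_inv σ⁻¹ w },
    length_directedFun σ, directedFun_prefix σ⟩

theorem hasWreathRecursion_directed (σ : Fin d → Equiv.Perm (Fin d)) :
    HasWreathRecursion (directed σ) (fun x => if x = 0 then directed σ else rooted (σ x)) 1 := by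
  intro x w
  show directedFun σ (x :: w) = _
  by_cases h : x = 0
  · simp only [directedFun, h, if_true]
    rfl
  · simp only [directedFun, h, if_false]
    rfl

theorem directed_eq_sections (σ : Fin d → Equiv.Perm (Fin d)) :
    directed σ = sections fun x => if x = 0 then directed σ else rooted (σ x) :=
  treeAut_ext <| by
    rintro (_ | ⟨x, w⟩)
    · rfl
    · exact hasWreathRecursion_directed σ x w

/-! ### Elements of the mother group with small support -/

/-- The subgroup generated by the alternating permutations of the first level and the directed
automorphisms with only one nontrivial permutation. -/
def branchGroup (d : ℕ) [NeZero d] : Subgroup (treeAut d) :=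
  Subgroup.closure ({g | ∃ τ ∈ alternatingGroup (Fin d), g = rootedHom τ} ∪
    {g | ∃ x ≠ 0, ∃ τ ∈ alternatingGroup (Fin d), g = directed (Pi.mulSingle x τ)})

theorem rootedHom_mem_branchGroup {τ : Equiv.Perm (Fin d)} (h : τ ∈ alternatingGroup (Fin d)) :
    rootedHom τ ∈ branchGroup d :=
  Subgroup.subset_closure (Or.inl ⟨τ, h, rfl⟩)

theorem directed_mem_branchGroup {x : Fin d} (hx : x ≠ 0) {τ : Equiv.Perm (Fin d)}
    (h : τ ∈ alternatingGroup (Fin d)) : directed (Pi.mulSingle x τ) ∈ branchGroup d :=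
  Subgroup.subset_closure (Or.inr ⟨x, hx, τ, h, rfl⟩)

theorem branchGroup_le : branchGroup d ≤ motherGroup d := by
  refine Subgroup.closure_mono ?_
  rintro _ (⟨τ, hτ, rfl⟩ | ⟨x, hx, τ, hτ, rfl⟩)
  · exact Or.inl ⟨τ, hτ, hasWreathRecursion_rooted τ⟩
  · refine Or.inr ⟨Pi.mulSingle x τ, 1, fun y => ?_, one_mem _, rfl,
      hasWreathRecursion_directed _⟩
    by_cases h : y = x
    · subst h
      simpa using hτ
    · rw [Pi.mulSingle_eq_of_ne h]
      exact one_mem _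

theorem below_mem_of_below_mem (hd : 4 ≤ d) {g : treeAut d} {c : Fin d}
    (h : below c g ∈ branchGroup d) (c' : Fin d) : below c' g ∈ branchGroup d := by
  obtain ⟨τ, hτ, rfl⟩ := exists_alternating_transitive hd c c'
  rw [← rootedHom_conj_below]
  exact mul_mem (mul_mem (rootedHom_mem_branchGroup hτ) h)
    (inv_mem (rootedHom_mem_branchGroup hτ))

open Classical in
theorem sections_directed_single {x : Fin d} (τ : Equiv.Perm (Fin d)) :
    directed (Pi.mulSingle x τ) = sections fun y =>
      if y = 0 then directed (Pi.mulSingle x τ) else if y = x then rootedHom τ else 1 := by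
  refine (directed_eq_sections _).trans (congrArg sections (funext fun y => ?_))
  by_cases h : y = x
  · subst h
    simp [rootedHom_apply]
  · rw [Pi.mulSingle_eq_of_ne h, ← rootedHom_apply, map_one]
    simp [h]

/-- The directed element of `τ` acts only below `0` and `x`. Conjugating that of `τ'` by a
permutation with `0 ↦ z`, `x ↦ x` gives one that acts only below `z` and `x`. Their commutator
survives only below `x`, as the commutator of `τ` and `τ'`. -/
theorem below_rootedHom_commutator_mem (hd : 4 ≤ d) {x : Fin d} (hx : x ≠ 0)
    {τ τ' : Equiv.Perm (Fin d)} (hτ : τ ∈ alternatingGroup (Fin d))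
    (hτ' : τ' ∈ alternatingGroup (Fin d)) : below x (rootedHom ⁅τ, τ'⁆) ∈ branchGroup d := by
  obtain ⟨z, hz0, hzx, -⟩ := exists_notMem_triple hd 0 x x
  obtain ⟨a, ha, ha0, hax⟩ := exists_alternating_apply_eq hd hz0.symm hx hzx.symm
  have hmem := Subgroup.commutator_mem_commutator
    (directed_mem_branchGroup hx hτ) (mul_mem (mul_mem (rootedHom_mem_branchGroup ha)
      (directed_mem_branchGroup hx hτ')) (inv_mem (rootedHom_mem_branchGroup ha)))
  have hle : ⁅branchGroup d, branchGroup d⁆ ≤ branchGroup d :=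
    Subgroup.commutator_le.2 fun g hg h hh =>
      mul_mem (mul_mem (mul_mem hg hh) (inv_mem hg)) (inv_mem hh)
  convert hle hmem using 1
  rw [sections_directed_single τ, sections_directed_single τ', rootedHom_conj_sections,
    ← map_commutatorElement, below_apply]
  congr 1
  funext y
  have hx' : a⁻¹ x = x := by rw [Equiv.Perm.inv_eq_iff_eq, hax]
  have h0 : a⁻¹ z = 0 := by rw [Equiv.Perm.inv_eq_iff_eq, ha0]
  rw [show ∀ s t : Fin d → treeAut d, ⁅s, t⁆ y = ⁅s y, t y⁆ from fun _ _ => rfl]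
  by_cases hyx : y = x
  · subst hyx
    simp [hx, hx', map_commutatorElement]
  · rw [Pi.mulSingle_eq_of_ne hyx]
    have hyx' : a⁻¹ y ≠ x := fun h => hyx (a⁻¹.injective (h.trans hx'.symm))
    by_cases hy0 : y = 0
    · have hy0' : a⁻¹ y ≠ 0 := fun h => hz0 ((a⁻¹.injective (h0.trans h.symm)).trans hy0)
      simp only [hyx', hy0', if_false, commutatorElement_one_right]
    · simp only [hyx, hy0, if_false, commutatorElement_one_left]

/-- For `5 ≤ d` the alternating group is perfect, so commutators generate all of it. -/
theorem below_rootedHom_mem (hd : 5 ≤ d) {τ : Equiv.Perm (Fin d)}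
    (hτ : τ ∈ alternatingGroup (Fin d)) (c : Fin d) : below c (rootedHom τ) ∈ branchGroup d := by
  obtain ⟨x, hx, -, -⟩ := exists_notMem_triple (by omega : 4 ≤ d) 0 0 0
  refine below_mem_of_below_mem (by omega) (c := x) ?_ c
  have hle : alternatingGroup (Fin d) ≤ (branchGroup d).comap ((below x).comp rootedHom) := by
    rw [← commutator_alternatingGroup_eq_self (α := Fin d) (by simpa using hd)]
    exact Subgroup.commutator_le.2 fun τ hτ τ' hτ' =>
      below_rootedHom_commutator_mem (by omega) hx hτ hτ'
  exact hle hτ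

/-- The group `branchGroup d` contains a copy of itself that acts only below the letter `c`. -/
theorem below_mem_branchGroup (hd : 5 ≤ d) {g : treeAut d} (hg : g ∈ branchGroup d) (c : Fin d) :
    below c g ∈ branchGroup d := by
  have hle : branchGroup d ≤ (branchGroup d).comap (below c) := by
    refine (Subgroup.closure_le _).2 ?_
    rintro _ (⟨τ, hτ, rfl⟩ | ⟨x, hx, τ, hτ, rfl⟩)
    · exact below_rootedHom_mem hd hτ c
    · refine below_mem_of_below_mem (by omega) (c := 0) ?_ c
      -- The second factor is already known to lie in the group, so the first does too; conjugation
      -- then moves it from `0` to `c`.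
      have h : directed (Pi.mulSingle x τ) =
          below 0 (directed (Pi.mulSingle x τ)) * below x (rootedHom τ) := by
        rw [below_apply, below_apply, ← map_mul]
        refine (sections_directed_single τ).trans (congrArg sections (funext fun y => ?_))
        rw [Pi.mul_apply]
        by_cases hy : y = 0
        · subst hy
          simp [Pi.mulSingle_eq_of_ne hx.symm]
        · by_cases hyx : y = x
          · subst hyx
            simp [hy]
          · simp [hy, hyx]
      rw [eq_mul_inv_iff_mul_eq.2 h.symm]
      exact mul_mem (directed_mem_branchGroup hx hτ) (inv_mem (below_rootedHom_mem hd hτ x))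
  exact hle hg

theorem exists_mem_branchGroup_below (hd : 5 ≤ d) {g : treeAut d} (hg : g ∈ branchGroup d)
    (w : List (Fin d)) : ∃ h ∈ branchGroup d,
      (∀ z, h • rayApp w z = rayApp w (g • z)) ∧
      ∀ w' : List (Fin d), w'.length = w.length → w' ≠ w → ∀ z, h • rayApp w' z = rayApp w' z := by
  induction w with
  | nil => exact ⟨g, hg, fun z => rfl, fun w' hl hne => absurd (List.length_eq_zero_iff.1 hl) hne⟩
  | cons c w ih =>
    obtain ⟨h, hh, h1, h2⟩ := ih
    refine ⟨below c h, below_mem_branchGroup hd hh c, fun z => ?_, ?_⟩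
    · rw [rayApp, below_smul_rayCons, h1, rayApp]
    · rintro (_ | ⟨c', w'⟩) hl hne z
      · simp at hl
      · by_cases hc : c' = c
        · subst hc
          rw [rayApp, below_smul_rayCons, h2 w' (by simpa using hl) fun h => hne (by rw [h])]
        · rw [rayApp, below_smul_rayCons_of_ne hc]

/-! ### Distinct points of the blow-up have distinct stabilisers -/

/-- Take prefixes on which the two rays differ. A permutation placed below that of `ξ'` moves the
next letter there and is trivial below that of `ξ`. -/
theorem exists_smul_eq_of_proj_ne (hd : 5 ≤ d) {ξ ξ' : BlowUp d} (h : proj ξ ≠ proj ξ') :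
    ∃ g : motherGroup d, g • ξ = ξ ∧ g • ξ' ≠ ξ' := by
  obtain ⟨i, hi⟩ := Function.ne_iff.1 h
  have hne : take (i + 1) ξ ≠ take (i + 1) ξ' := by
    intro he
    have h1 := getElem_take (i + 1) i ξ (by simp)
    simp only [he] at h1
    rw [getElem_take] at h1
    exact hi h1.symm
  set c := head (drop (i + 1) ξ') with hc
  obtain ⟨y, hy, -, -⟩ := exists_notMem_triple (by omega : 4 ≤ d) c c c
  obtain ⟨τ, hτ, hτc⟩ := exists_alternating_transitive (by omega : 4 ≤ d) c y
  obtain ⟨g, hg, h1, h2⟩ := exists_mem_branchGroup_below hd (rootedHom_mem_branchGroup hτ)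
    (take (i + 1) ξ')
  refine ⟨⟨g, branchGroup_le hg⟩, ?_, fun he => hy ?_⟩
  · have := (isLift_lift ⟨g, branchGroup_le hg⟩).app_eq (w := take (i + 1) ξ)
      (w' := take (i + 1) ξ) rfl (b := Directed.one)
      (fun ζ => by rw [Directed.act_one, h2 _ (by simp) hne]) (drop (i + 1) ξ)
    rwa [Directed.act_one, app_take_drop] at this
  · have h3 := (proj_smul _ _).symm.trans (congrArg proj he)
    rw [← app_take_drop (i + 1) ξ', proj_app, ← cons_head_tail (drop (i + 1) ξ'), proj_cons] at h3
    have h4 := (h1 _).symm.trans h3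
    rw [rootedHom_apply, rooted_smul_rayCons] at h4
    exact hτc.symm.trans (rayCons_inj.1 (rayApp_inj rfl h4).2).1

theorem state_ext {s s' : State d} (h : letter s = letter s') (hp : s.2 = s'.2) : s = s' := by
  obtain ⟨k, p⟩ := s
  obtain ⟨k', p'⟩ := s'
  obtain rfl : p = p' := hp
  have := p.1.2
  cases k <;> cases k' <;> simp_all [letter]

/-- Over one ray, two points differ in the pointers `(x, a)` and `(x', a')` at some position. Below
the common prefix, place the directed element whose only permutation `τ` sits at `x'`, with `τ a' ≠
a'`, and with `τ a = a` in case `x = x'`. It fixes the first pointer and moves the second. -/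
theorem exists_smul_eq_of_ne (hd : 5 ≤ d) {ξ ξ' : BlowUp d} (h : ξ ≠ ξ') :
    ∃ g : motherGroup d, g • ξ = ξ ∧ g • ξ' ≠ ξ' := by
  by_cases hp : proj ξ = proj ξ'
  swap
  · exact exists_smul_eq_of_proj_ne hd hp
  obtain ⟨n, hn⟩ : ∃ n, (ξ.1 n).2 ≠ (ξ'.1 n).2 := by
    by_contra! hs
    exact h (BlowUp.ext fun n => state_ext (congrFun hp n) (hs n))
  obtain ⟨τ, hτ, hτ', hor⟩ : ∃ τ ∈ alternatingGroup (Fin d), τ (ξ'.1 n).2.2 ≠ (ξ'.1 n).2.2 ∧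
      ((ξ.1 n).2.1 ≠ (ξ'.1 n).2.1 ∨ τ (ξ.1 n).2.2 = (ξ.1 n).2.2) := by
    by_cases h1 : (ξ.1 n).2.1 = (ξ'.1 n).2.1
    · have h2 : (ξ.1 n).2.2 ≠ (ξ'.1 n).2.2 := fun h2 => hn (Prod.ext h1 h2)
      obtain ⟨y, hy, hy', -⟩ :=
        exists_notMem_triple (by omega : 4 ≤ d) (ξ'.1 n).2.2 (ξ.1 n).2.2 0
      obtain ⟨τ, hτ, h3, h4⟩ := exists_alternating_apply_eq (by omega : 4 ≤ d) hy.symm h2 hy'.symm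
      exact ⟨τ, hτ, by rwa [h3], Or.inr h4⟩
    · obtain ⟨y, hy, -, -⟩ := exists_notMem_triple (by omega : 4 ≤ d) (ξ'.1 n).2.2 0 0
      obtain ⟨τ, hτ, h3⟩ := exists_alternating_transitive (by omega : 4 ≤ d) (ξ'.1 n).2.2 y
      exact ⟨τ, hτ, by rwa [h3], Or.inl h1⟩
  let b : Directed d := ⟨Pi.mulSingle (ξ'.1 n).2.1.1 τ, 1, rfl⟩
  obtain ⟨g, hg, h1, -⟩ := exists_mem_branchGroup_below hd
    (directed_mem_branchGroup (ξ'.1 n).2.1.2 hτ) (take n ξ)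
  have happ : ∀ ζ, (⟨g, branchGroup_le hg⟩ : motherGroup d) • app (take n ξ) ζ =
      app (take n ξ) (b.act ζ) :=
    (isLift_lift ⟨g, branchGroup_le hg⟩).app_eq rfl fun ζ => by
      rw [Directed.IsRecursion.proj_act (b := b) (hasWreathRecursion_directed _)]
      exact h1 _
  refine ⟨⟨g, branchGroup_le hg⟩, ?_, fun he => hτ' ?_⟩
  · have h2 := happ (drop n ξ)
    rwa [Directed.act_eq_self, app_take_drop] at h2
    rw [drop_val, add_zero]
    refine Prod.ext rfl ?_
    show (Pi.mulSingle (ξ'.1 n).2.1.1 τ : Fin d → Equiv.Perm (Fin d)) (ξ.1 n).2.1.1 _ = _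
    rcases hor with h3 | h3
    · rw [Pi.mulSingle_eq_of_ne fun h4 => h3 (Subtype.ext h4)]
      rfl
    · by_cases h4 : (ξ.1 n).2.1.1 = (ξ'.1 n).2.1.1
      · rw [h4, Pi.mulSingle_eq_same, h3]
      · rw [Pi.mulSingle_eq_of_ne h4]
        rfl
  · have h2 := happ (drop n ξ')
    have ht : take n ξ = take n ξ' := take_eq_of_proj_eq hp n
    rw [ht, app_take_drop, he] at h2
    have h3 : b.act (drop n ξ') = drop n ξ' :=
      app_injective (take n ξ') (h2.symm.trans (app_take_drop n ξ').symm)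
    have h4 := congrArg Prod.snd (Directed.ptr_of_act_eq_self h3)
    rw [drop_val, add_zero] at h4
    have h5 : (Pi.mulSingle (ξ'.1 n).2.1.1 τ : Fin d → Equiv.Perm (Fin d)) (ξ'.1 n).2.1.1
      (ξ'.1 n).2.2 = (ξ'.1 n).2.2 := h4
    rwa [Pi.mulSingle_eq_same] at h5

theorem injective_stabilizer (hd : 5 ≤ d) :
    Function.Injective fun ξ : BlowUp d => MulAction.stabilizer (motherGroup d) ξ := by
  intro ξ ξ' h
  by_contra hne
  obtain ⟨g, hg, hg'⟩ := exists_smul_eq_of_ne hd hne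
  have h1 : g ∈ MulAction.stabilizer (motherGroup d) ξ := hg
  rw [show MulAction.stabilizer (motherGroup d) ξ = MulAction.stabilizer (motherGroup d) ξ'
    from h] at h1
  exact hg' h1

theorem nonempty_blowUp (hd : 5 ≤ d) : Nonempty (BlowUp d) := by
  obtain ⟨x, hx, -, -⟩ := exists_notMem_triple (by omega : 4 ≤ d) 0 0 0
  obtain ⟨ξ, -, -⟩ := exists_recurrent_state ((true, ⟨x, hx⟩, x) : State d)
  exact ⟨ξ⟩

theorem stabilizer_mem_stabilitySet (ξ : BlowUp d) :
    MulAction.stabilizer (motherGroup d) ξ ∈ stabilitySet (motherGroup d) (TreeBoundary d) := by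
  have : Nonempty (BlowUp d) := ⟨ξ⟩
  rw [stabilitySet_eq_range]
  exact mem_range_self ξ

theorem bijective_stabilizer (hd : 5 ≤ d) : Function.Bijective fun ξ : BlowUp d =>
    (⟨MulAction.stabilizer (motherGroup d) ξ, stabilizer_mem_stabilitySet ξ⟩ :
      SchreierSystem d) := by
  refine ⟨fun ξ ξ' h => injective_stabilizer hd (congrArg Subtype.val h), fun ⟨H, hH⟩ => ?_⟩
  have := nonempty_blowUp hd
  rw [stabilitySet_eq_range] at hH
  obtain ⟨ξ, hξ⟩ := hH
  exact ⟨ξ, Subtype.ext hξ⟩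

/-- The blow-up is the Schreier dynamical system. -/
def blowUpHomeomorph (hd : 5 ≤ d) : BlowUp d ≃ₜ SchreierSystem d :=
  Continuous.homeoOfEquivCompactToT2 (f := Equiv.ofBijective _ (bijective_stabilizer hd))
    (continuous_stabilizer.subtype_mk _)

theorem blowUpHomeomorph_smul (hd : 5 ≤ d) (g : motherGroup d) (ξ : BlowUp d) :
    blowUpHomeomorph hd (g • ξ) = g • blowUpHomeomorph hd ξ :=
  Subtype.ext (MulAction.stabilizer_smul_eq_stabilizer_map_conj g ξ)

end Separation

/-! ### The Bratteli diagram of states, and bounded type. -/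

section Diagram

/-! ### The isotropy groups of topologically regular actions -/

theorem subsingleton_germIsotropy {G Y : Type*} [Group G] [TopologicalSpace Y] [MulAction G Y]
    [ContinuousConstSMul G Y] {y : Y} (h : IsTopologicallyRegularPoint G y) :
    Subsingleton (GermIsotropy G y) := by
  refine ⟨fun a b => CategoryTheory.Iso.ext ?_⟩
  induction a.hom using Quotient.inductionOn with | _ g
  induction b.hom using Quotient.inductionOn with | _ k
  refine Quotient.sound ?_
  filter_upwards [h g.1 g.2, h k.1 k.2] with z hz hz'
  rw [hz, hz']

/-! ### The Bratteli diagram -/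

variable {d : ℕ} [NeZero d]

/-- The stationary diagram whose edges put a letter in front of a state. -/
def diagram (h : Nonempty (State d)) : BratteliDiagram where
  V := fun | 0 => Unit | _ + 1 => State d
  -- The first edge chooses the state at position `0`, so the vertex of a path on level `n + 1` is
  -- its state at position `n`. An edge `(c, s)` runs from `prev c s` to `s`.
  E := fun | 0 => State d | _ + 1 => Fin d × State d
  finite_V := by rintro (_ | n) <;> infer_instance
  finite_E := by rintro (_ | n) <;> infer_instance
  o := fun {n} => match n with
    | 0 => fun _ => ()
    | _ + 1 => fun e => prev e.1 e.2
  t := fun {n} => match n with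
    | 0 => fun e => e
    | _ + 1 => fun e => e.2
  top := ()
  eq_top _ := rfl
  exists_o_eq := by
    rintro (_ | n) v
    · exact ⟨h.some, rfl⟩
    · obtain ⟨k, x, a⟩ := v
      cases k with
      | true => exact ⟨((0 : Fin d), (true, x, a)), prev_zero _⟩
      | false =>
        refine ⟨((x : Fin d), prev a (true, x, a)), ?_⟩
        exact (prev_of_ne x.2 _).trans (by rw [letter_prev])
  exists_t_eq := by
    rintro (_ | n) v
    · exact ⟨v, rfl⟩
    · exact ⟨((0 : Fin d), v), rfl⟩

variable {h : Nonempty (State d)}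

theorem isStationary_diagram : (diagram h).IsStationary :=
  ⟨State d, fun _ => Equiv.refl _, fun _ _ _ => rfl⟩

/-- The words `0 x a` and `x a 0` force the first state whatever follows. So three steps connect any
two vertices below the top, which gives simplicity. -/
theorem exists_prev_prev_prev_eq (s w : State d) :
    ∃ a b c : Fin d, prev a (prev b (prev c w)) = s := by
  obtain ⟨k, x, a⟩ := s
  cases k with
  | true => exact ⟨0, x, a, by simp [prev_of_ne x.2]⟩
  | false => exact ⟨x, a, 0, by simp [prev_of_ne x.2]⟩

theorem isSimple_diagram : (diagram h).IsSimple := by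
  rintro (_ | n) v
  · exact ⟨1, one_pos, fun w =>
      BratteliDiagram.Reaches.step (B := diagram h) (m := 0) w BratteliDiagram.Reaches.refl⟩
  · refine ⟨n + 4, by omega, fun w => ?_⟩
    obtain ⟨a, b, c, habc⟩ := exists_prev_prev_prev_eq v w
    have h1 : (diagram h).Reaches v (n + 1) (prev a (prev b (prev c w))) :=
      habc ▸ BratteliDiagram.Reaches.refl
    have h2 : (diagram h).Reaches v (n + 2) (prev b (prev c w)) :=
      BratteliDiagram.Reaches.step (B := diagram h) (m := n + 1) (a, prev b (prev c w)) h1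
    have h3 : (diagram h).Reaches v (n + 3) (prev c w) :=
      BratteliDiagram.Reaches.step (B := diagram h) (m := n + 2) (b, prev c w) h2
    exact BratteliDiagram.Reaches.step (B := diagram h) (m := n + 3) (c, w) h3

/-- The edges of the path given by a point of the blow-up. -/
def pathEdge (ξ : BlowUp d) : ∀ n, (diagram h).E n
  | 0 => ξ.1 0
  | n + 1 => (letter (ξ.1 n), ξ.1 (n + 1))

theorem t_pathEdge (ξ : BlowUp d) (n : ℕ) :
    (diagram h).t (pathEdge (h := h) ξ n) = (ξ.1 n : State d) := by
  cases n <;> rfl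

theorem pathEdge_congr {ξ η : BlowUp d} {n : ℕ} (he : ∀ i ≤ n, ξ.1 i = η.1 i) :
    pathEdge (h := h) ξ n = pathEdge η n := by
  cases n with
  | zero => exact he 0 le_rfl
  | succ n => exact Prod.ext (congrArg letter (he n n.le_succ)) (he (n + 1) le_rfl)

/-- The path space of the diagram is the blow-up. -/
def pathEquiv (h : Nonempty (State d)) : BlowUp d ≃ (diagram h).PathSpace where
  toFun ξ := ⟨pathEdge ξ, fun n => (t_pathEdge ξ n).trans (ξ.2 n)⟩
  invFun x := ⟨fun n => (diagram h).t (x.edge n), fun n => by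
    have hc : (diagram h).t (x.edge n) = prev (x.edge (n + 1)).1 (x.edge (n + 1)).2 := x.compat n
    have hl : letter ((diagram h).t (x.edge n)) = (x.edge (n + 1)).1 :=
      (congrArg letter hc).trans (letter_prev _ _)
    rw [hl]
    exact hc⟩
  left_inv ξ := BlowUp.ext fun n => t_pathEdge ξ n
  right_inv x := by
    refine BratteliDiagram.PathSpace.ext (funext fun n => ?_)
    cases n with
    | zero => rfl
    | succ n =>
      have hc : (diagram h).t (x.edge n) = prev (x.edge (n + 1)).1 (x.edge (n + 1)).2 := x.compat n
      exact Prod.ext ((congrArg letter hc).trans (letter_prev _ _)) rfl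

/-- The homeomorphism from the blow-up to the path space of the diagram. -/
def pathHomeomorph (h : Nonempty (State d)) : BlowUp d ≃ₜ (diagram h).PathSpace where
  toEquiv := pathEquiv h
  continuous_toFun := by
    refine continuous_induced_rng.2 (continuous_pi fun n => ?_)
    cases n with
    | zero => exact continuous_discrete_rng.2 fun s => isOpen_state_eq 0 s
    | succ n =>
      refine continuous_discrete_rng.2 fun e => ?_
      exact (isOpen_discrete (α := Fin d × State d) {e}).preimage
        (((continuous_of_discreteTopology (f := letter)).comp (continuous_state n)).prodMk
          (continuous_state (n + 1)))
  continuous_invFun := by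
    refine Continuous.subtype_mk (continuous_pi fun n => ?_) _
    have ht : Continuous fun e : (diagram h).E n => (show State d from (diagram h).t e) :=
      continuous_of_discreteTopology
    exact ht.comp (BratteliDiagram.PathSpace.continuous_edge (diagram h) n)

/-- The beginning of an infinite path. -/
def trunc {B : BratteliDiagram} (n : ℕ) (x : B.PathSpace) : B.FinPath n :=
  ⟨fun i _ => x.edge i, fun i _ => x.compat i⟩

theorem eq_trunc_of_mem {B : BratteliDiagram} {n : ℕ} {γ : B.FinPath n} {x : B.PathSpace}
    (hx : x ∈ BratteliDiagram.cylinder γ) : γ = trunc n x := by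
  obtain ⟨e, c⟩ := γ
  obtain rfl : e = fun i _ => x.edge i := funext fun i => funext fun hi => (hx i hi).symm
  rfl

theorem tau_mem_tailPseudogroup {B : BratteliDiagram} {n : ℕ} {γ γ' : B.FinPath n}
    (ht : γ.target = γ'.target) : BratteliDiagram.tau γ γ' ht ∈ B.tailPseudogroup := by
  exact mem_iInter₂.2 fun _ hG => hG.2 n γ γ' ht

theorem app_val (w : List (Fin d)) {n k : ℕ} (hw : w.length = n) (hk : n ≤ k) (ξ : BlowUp d) :
    (app w ξ).1 k = ξ.1 (k - n) := by
  have h1 := drop_val n (k - n) (app w ξ)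
  rwa [drop_app hw, Nat.add_sub_cancel' hk, eq_comm] at h1

theorem take_eq_of_state_eq {n : ℕ} {ξ η : BlowUp d} (he : ∀ i ≤ n, ξ.1 i = η.1 i) :
    take n ξ = take n η := by
  refine List.ext_getElem (by simp) fun i h1 h2 => ?_
  rw [getElem_take, getElem_take, he i (by simp at h1; omega)]

theorem state_eq_of_mem_cylinder {n : ℕ} {ξ η : BlowUp d}
    (hx : pathHomeomorph h η ∈ BratteliDiagram.cylinder (trunc n (pathHomeomorph h ξ))) :
    ∀ i ≤ n, η.1 i = ξ.1 i := fun i hi => by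
  rw [← t_pathEdge (h := h) η, ← t_pathEdge (h := h) ξ]
  exact congrArg _ (hx i hi)

theorem mem_cylinder_trunc {B : BratteliDiagram} (n : ℕ) (x : B.PathSpace) :
    x ∈ BratteliDiagram.cylinder (trunc n x) := fun _ _ => rfl

/-- A homeomorphism with a trivial section at a word replaces the beginnings of the paths that
start with this word. -/
theorem exists_eqOn_tau {F : (diagram h).PathSpace ≃ₜ (diagram h).PathSpace}
    {f : BlowUp d → BlowUp d} (hF : ∀ ξ, F (pathHomeomorph h ξ) = pathHomeomorph h (f ξ))
    {n : ℕ} {ξ : BlowUp d} (ht : TrivAt f (take n ξ)) :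
    ∃ (γ' : (diagram h).FinPath n) (he : (trunc n (pathHomeomorph h ξ)).target = γ'.target),
      EqOn F (BratteliDiagram.tau (trunc n (pathHomeomorph h ξ)) γ' he)
        (BratteliDiagram.cylinder (trunc n (pathHomeomorph h ξ))) := by
  obtain ⟨w', hl, hw'⟩ := ht
  rw [length_take] at hl
  have hξ : f ξ = app w' (drop n ξ) := by rw [← hw', app_take_drop]
  -- A trivial section leaves the states from position `n` on unchanged, in particular the end
  -- vertex of the path.
  have hs : ∀ ζ : BlowUp d, ∀ k ≥ n, (app w' (drop n ζ)).1 k = ζ.1 k := fun ζ k hk => by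
    rw [app_val w' hl hk, drop_val, Nat.add_sub_cancel' hk]
  have he : (trunc n (pathHomeomorph h ξ)).target = (trunc n (pathHomeomorph h (f ξ))).target := by
    refine (t_pathEdge ξ n).trans (Eq.trans ?_ (t_pathEdge (f ξ) n).symm)
    rw [hξ, hs ξ n le_rfl]
  refine ⟨trunc n (pathHomeomorph h (f ξ)), he, fun x hx => ?_⟩
  obtain ⟨ζ, rfl⟩ := (pathHomeomorph h).surjective x
  have hζs := state_eq_of_mem_cylinder hx
  have hζ : f ζ = app w' (drop n ζ) := by
    rw [← hw', ← take_eq_of_state_eq hζs, app_take_drop]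
  have hfs : ∀ i ≤ n, (f ζ).1 i = (f ξ).1 i := by
    refine state_eq_of_take ?_ ?_
    · rw [hζ, hξ, take_app hl, take_app hl]
    · rw [hζ, hξ, hs ζ n le_rfl, hs ξ n le_rfl, hζs n le_rfl]
  rw [hF]
  refine Eq.trans ?_ (BratteliDiagram.swap_of_mem he hx).symm
  refine BratteliDiagram.PathSpace.ext (funext fun i => ?_)
  by_cases hi : i ≤ n
  · refine Eq.trans ?_ (dif_pos hi).symm
    exact pathEdge_congr fun j hj => hfs j (hj.trans hi)
  · refine Eq.trans ?_ (dif_neg hi).symm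
    obtain ⟨j, rfl⟩ : ∃ j, i = j + 1 := ⟨i - 1, by omega⟩
    refine Prod.ext (congrArg letter ?_) ?_
    · rw [hζ, hs ζ j (by omega)]
    · show (f ζ).1 (j + 1) = ζ.1 (j + 1)
      rw [hζ, hs ζ (j + 1) (by omega)]

/-- Only finitely many points have nontrivial sections along all of their prefixes. -/
theorem finite_setOf_not_trivAt {f : BlowUp d → BlowUp d} {K : ℕ}
    (hK : ∀ n, {w : List (Fin d) | w.length = n ∧ ¬ TrivAt f w}.encard ≤ K) :
    {ξ : BlowUp d | ∀ n, ¬ TrivAt f (take n ξ)}.Finite := by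
  by_contra hinf
  -- Pigeonhole: for large `n` the points of `t` are told apart by their first `n` letters and their
  -- state at `n`, and at most `K` words and `Nat.card (State d)` states are available.
  obtain ⟨t, ht, hc⟩ := Set.Infinite.exists_subset_card_eq hinf (K * Nat.card (State d) + 1)
  have hev : ∀ᶠ n in atTop, ∀ ξ ∈ t, ∀ η ∈ t,
      take n ξ = take n η → ξ.1 n = η.1 n → ξ = η := by
    refine (Finset.eventually_all t).2 fun ξ _ => (Finset.eventually_all t).2 fun η _ => ?_
    by_cases he : ξ = η
    · exact Eventually.of_forall fun _ _ _ => he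
    · obtain ⟨i, hi⟩ : ∃ i, ξ.1 i ≠ η.1 i := by
        by_contra! hs
        exact he (BlowUp.ext hs)
      filter_upwards [eventually_ge_atTop i] with n hn h1 h2
      exact absurd (state_eq_of_take h1 h2 i hn) hi
  obtain ⟨n, hn⟩ := hev.exists
  have hle : (t : Set (BlowUp d)).encard ≤
      ({w : List (Fin d) | w.length = n ∧ ¬ TrivAt f w} ×ˢ (univ : Set (State d))).encard :=
    Set.encard_le_encard_of_injOn (f := fun ξ : BlowUp d => (take n ξ, ξ.1 n))
      (fun ξ hξ => ⟨⟨length_take n ξ, ht hξ n⟩, trivial⟩)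
      (fun ξ hξ η hη he => hn ξ hξ η hη (congrArg Prod.fst he) (congrArg Prod.snd he))
  rw [Set.encard_coe_eq_coe_finsetCard, hc, Set.encard_prod, Set.encard_univ,
    ENat.card_eq_coe_natCard] at hle
  have h2 := hle.trans (mul_le_mul_left (hK n) _)
  norm_cast at h2
  omega

/-- A homeomorphism with a bounded number of nontrivial sections on each level is of bounded
type. -/
theorem isBoundedType_of_bounded {F : (diagram h).PathSpace ≃ₜ (diagram h).PathSpace}
    {f : BlowUp d → BlowUp d} (hF : ∀ ξ, F (pathHomeomorph h ξ) = pathHomeomorph h (f ξ))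
    {K : ℕ} (hK : ∀ n, {w : List (Fin d) | w.length = n ∧ ¬ TrivAt f w}.encard ≤ K) :
    (diagram h).IsBoundedType F := by
  refine ⟨⟨K, fun n v => ?_⟩, ?_⟩
  · obtain ⟨η, -, hη⟩ := exists_recurrent_state (d := d) v
    refine (Set.encard_le_encard ?_).trans ((Set.encard_image_le
      (fun w => trunc n (pathHomeomorph h (app w η))) _).trans (hK n))
    rintro γ ⟨hγ, hbad⟩
    by_cases hne : (BratteliDiagram.cylinder γ).Nonempty
    · obtain ⟨x, hx⟩ := hne
      obtain rfl := eq_trunc_of_mem hx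
      obtain ⟨ξ, rfl⟩ := (pathHomeomorph h).surjective x
      refine ⟨take n ξ, ⟨length_take n ξ, fun ht => hbad (exists_eqOn_tau hF ht)⟩, ?_⟩
      refine (eq_trunc_of_mem fun i hi => ?_).symm
      refine pathEdge_congr fun j hj => ?_
      refine state_eq_of_take (take_app (length_take n ξ) η) ?_ j (hj.trans hi)
      rw [app_val _ (length_take n ξ) le_rfl, Nat.sub_self, hη, ← hγ]
      exact t_pathEdge ξ n
    -- On an empty cylinder every equality of maps holds vacuously.
    · refine absurd ⟨γ, rfl, fun x hx => absurd ⟨x, hx⟩ hne⟩ hbad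
  · refine ((finite_setOf_not_trivAt hK).image (pathHomeomorph h)).subset fun x hx => ?_
    obtain ⟨ξ, rfl⟩ := (pathHomeomorph h).surjective x
    refine ⟨ξ, fun n ht => hx ?_, rfl⟩
    obtain ⟨γ', he, hE⟩ := exists_eqOn_tau (h := h) hF ht
    refine ⟨_, tau_mem_tailPseudogroup he, mem_cylinder_trunc n _, ?_⟩
    exact hE.eventuallyEq_of_mem
      ((BratteliDiagram.isOpen_cylinder _).mem_nhds (mem_cylinder_trunc n _))

/-- The action on the path space that corresponds to the action on the blow-up. -/
abbrev pathAction (h : Nonempty (State d)) : MulAction (motherGroup d) (diagram h).PathSpace :=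
  (pathEquiv h).symm.mulAction (motherGroup d)

attribute [local instance] pathAction

theorem smul_pathHomeomorph (g : motherGroup d) (ξ : BlowUp d) :
    g • pathHomeomorph h ξ = pathHomeomorph h (g • ξ) := by
  show pathEquiv h (g • (pathEquiv h).symm (pathEquiv h ξ)) = _
  rw [Equiv.symm_apply_apply]
  rfl

theorem continuousConstSMul_pathSpace :
    ContinuousConstSMul (motherGroup d) (diagram h).PathSpace where
  continuous_const_smul g := (pathHomeomorph h).continuous.comp
    ((continuous_const_smul g).comp (pathHomeomorph h).symm.continuous)

theorem isTopologicallyRegular_pathSpace :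
    IsTopologicallyRegular (motherGroup d) (diagram h).PathSpace := by
  intro x g hg
  obtain ⟨ξ, rfl⟩ := (pathHomeomorph h).surjective x
  rw [smul_pathHomeomorph, (pathHomeomorph h).injective.eq_iff] at hg
  rw [← (pathHomeomorph h).map_nhds_eq, eventually_map]
  filter_upwards [isTopologicallyRegular_blowUp ξ g hg] with ζ hζ
  rw [smul_pathHomeomorph, hζ]

end Diagram

end

end MotherGroup

open MotherGroup in
theorem theoremT (d : ℕ) [NeZero d] (hd : 5 ≤ d) :
    ∃ B : BratteliDiagram, B.IsStationary ∧ B.IsSimple ∧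
      ∃ (_ : MulAction (motherGroup d) B.PathSpace)
        (_ : ContinuousConstSMul (motherGroup d) B.PathSpace)
        (φ : SchreierSystem d ≃ₜ B.PathSpace),
        (∀ (g : motherGroup d) (x : SchreierSystem d), φ (g • x) = g • φ x) ∧
        (∀ g : motherGroup d, B.IsBoundedType (Homeomorph.smul g)) ∧
        IsTopologicallyRegular (motherGroup d) B.PathSpace ∧
        ∀ x : B.PathSpace, Subsingleton (GermIsotropy (motherGroup d) x) := by
  have h : Nonempty (State d) := (nonempty_blowUp hd).map fun ξ => ξ.1 0
  refine ⟨diagram h, isStationary_diagram, isSimple_diagram, pathAction h,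
    continuousConstSMul_pathSpace, (blowUpHomeomorph hd).symm.trans (pathHomeomorph h),
    fun g x => ?_, fun g => ?_, isTopologicallyRegular_pathSpace, fun x => ?_⟩
  · obtain ⟨ξ, rfl⟩ := (blowUpHomeomorph hd).surjective x
    rw [← blowUpHomeomorph_smul, Homeomorph.trans_apply, Homeomorph.trans_apply,
      Homeomorph.symm_apply_apply, Homeomorph.symm_apply_apply]
    exact (smul_pathHomeomorph g ξ).symm
  · obtain ⟨K, hK⟩ := (isLift_lift g).bounded
    let := pathAction h
    have := continuousConstSMul_pathSpace (h := h)
    exact isBoundedType_of_bounded (fun ξ => smul_pathHomeomorph g ξ) hK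
  · let := pathAction h
    have := continuousConstSMul_pathSpace (h := h)
    exact subsingleton_germIsotropy (isTopologicallyRegular_pathSpace x)
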